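/- Let $\mathbf T=\{\zeta\in\mathbf C:|\zeta|=1\}$ with Haar probability measure $d\zeta=d\theta/2\pi$ ($\zeta=e^{\sqrt{-1}\theta}$), and let $\mathcal M(\mathbf T)$ be the set of Borel probability measures on $\mathbf T$ with the weak topology. For $\mu\in\mathcal M(\mathbf T)$ let $$\Sigma(\mu):=\iint_{\mathbf T^2}\log|\zeta-\eta|\,d\mu(\zeta)\,d\mu(\eta)\in[-\infty,\infty),\qquad \log 0:=-\infty .$$ Let $Q:\mathbf T\to\mathbf R$ be continuous. For $n\ge1$ and $(\zeta_1,\dots,\zeta_{n-1})\in\mathbf T^{n-1}$ put $\zeta_n:=(\zeta_1\cdots\zeta_{n-1})^{-1}$, and let $\tilde\lambda_n^{\rm SU}(Q)$ be the probability measure on $\mathbf T^{n-1}$ $$d\tilde\lambda_n^{\rm SU}(Q)(\zeta_1,\dots,\zeta_{n-1}):=\frac1{\widetilde Z_n^{\rm SU}(Q)}\exp\Bigl(-n\sum_{i=1}^nQ(\zeta_i)\Bigr)\prod_{1\le i<j\le n}|\zeta_i-\zeta_j|^2\prod_{i=1}^{n-1}d\zeta_i,$$ where $\widetilde Z_n^{\rm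 SU}(Q)$ is the normalization constant (this is the joint eigenvalue distribution of the $n\times n$ special unitary random matrix associated with $Q$). Theorem. (1) The finite limit $B(Q):=\lim_{n\to\infty}\frac1{n^2}\log\widetilde Z_n^{\rm SU}(Q)$ exists. (2) When $(\zeta_1,\dots,\zeta_{n-1})$ is distributed according to $\tilde\lambda_n^{\rm SU}(Q)$, the empirical distribution $\kappa_n:=\frac1n(\delta_{\zeta_1}+\cdots+\delta_{\zeta_{n-1}}+\delta_{\zeta_n})$ satisfies the large deviation principle in $\mathcal M(\mathbf T)$ in the scale $1/n^2$ with the rate function $$\widetilde\Sigma_Q(\mu):=-\Sigma(\mu)+\int_{\mathbf T}Q\,d\mu+B(Q),\qquad\mu\in\mathcal M(\mathbf T).$$ That is, $\widetilde\Sigma_Q:\mathcal M(\mathbf T)\to[0,\infty]$ is lower semicontinuous with compact sublevel sets $\{\widetilde\Sigma_Q\le c\}$, $c\in\mathbf R$, and $$\limsup_{n\to\infty}\frac1{n^2}\log\tilde\lambda_n^{\rm SU}(Q)\{\kappa_n\in F\}\le-\inf_{\mu\in F}\widetilde\Sigma_Q(\mu),\qquad \liminf_{n\to\infty}\frac1{n^2}\log\tilde\lambda_n^{\rm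 SU}(Q)\{\kappa_n\in G\}\ge-\inf_{\mu\in G}\widetilde\Sigma_Q(\mu)$$ for every closed $F\subset\mathcal M(\mathbf T)$ and every open $G\subset\mathcal M(\mathbf T)$. (3) There is a unique minimizer $\mu_Q\in\mathcal M(\mathbf T)$ of $\widetilde\Sigma_Q$, and $\widetilde\Sigma_Q(\mu_Q)=0$. -/

import Mathlib

open MeasureTheory Filter Topology
open scoped ENNReal

noncomputable section

/-- The unit circle `𝕋` carries its Borel σ-algebra. -/
instance instMeasurableSpaceUnitCircle : MeasurableSpace Circle := borel Circle

instance instBorelSpaceUnitCircle : BorelSpace Circle := ⟨rfl⟩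

/-- The Haar probability measure `dζ = dθ / 2π` on the unit circle, where `ζ = e^{iθ}` with
`θ ∈ [-π, π)`. -/
def circleHaar : Measure Circle :=
  ENNReal.ofReal (2 * Real.pi)⁻¹ •
    (volume.restrict (Set.Ico (-Real.pi) Real.pi)).map (fun θ : ℝ => Circle.exp θ)

instance instIsProbabilityMeasureCircleHaar : IsProbabilityMeasure circleHaar := by
  constructor
  have hm : Measurable (fun θ : ℝ => Circle.exp θ) := Circle.exp.continuous.measurable
  have hpi := Real.pi_pos
  rw [circleHaar, Measure.smul_apply, Measure.map_apply hm MeasurableSet.univ, Set.preimage_univ,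
    Measure.restrict_apply_univ, Real.volume_Ico, smul_eq_mul,
    ← ENNReal.ofReal_mul (by positivity), ← ENNReal.ofReal_one]
  congr 1
  field_simp
  ring

/-- The integral of an extended-real-valued function: integral of the positive part minus integral
of the negative part. (It is used below only for a function whose positive part is bounded, so
that the difference is never of the form `∞ - ∞`.) -/
def extIntegral {X : Type*} [MeasurableSpace X] (f : X → EReal) (μ : Measure X) : EReal :=
  ((∫⁻ x, (f x).toENNReal ∂μ : ℝ≥0∞) : EReal) - ((∫⁻ x, (-f x).toENNReal ∂μ : ℝ≥0∞) : EReal)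

/-- The free entropy `Σ(μ) = ∬ log |ζ - η| dμ(ζ) dμ(η) ∈ [-∞, ∞)` of a probability measure on the
unit circle, where `log 0 = -∞`. -/
def freeEntropy (μ : ProbabilityMeasure Circle) : EReal :=
  extIntegral (fun p : Circle × Circle => ENNReal.log ‖(p.1 : ℂ) - (p.2 : ℂ)‖ₑ)
    ((μ : Measure Circle).prod (μ : Measure Circle))

/-- The function `μ ↦ -Σ(μ) + ∫ Q dμ + B` with values in `(-∞, ∞]`. -/
def relFreeEntropy (Q : Circle → ℝ) (B : ℝ) (μ : ProbabilityMeasure Circle) : EReal :=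
  -freeEntropy μ + ((∫ ζ, Q ζ ∂(μ : Measure Circle) : ℝ) : EReal) + (B : EReal)

/-- For `n = m + 1`, the `n`-tuple `(ζ₁, …, ζ_{n-1}, ζ_n)` with `ζ_n = (ζ₁ ⋯ ζ_{n-1})⁻¹`. -/
def suTuple {m : ℕ} (z : Fin m → Circle) : Fin (m + 1) → Circle :=
  Fin.snoc (α := fun _ => Circle) z (∏ i, z i)⁻¹

/-- For `n = m + 1`, the function
`exp (-n ∑_{i ≤ n} Q(ζ_i)) ∏_{i < j ≤ n} |ζ_i - ζ_j|²` of `(ζ₁, …, ζ_{n-1})`. -/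
def suWeight (Q : Circle → ℝ) (m : ℕ) (z : Fin m → Circle) : ℝ :=
  Real.exp (-((m : ℝ) + 1) * ∑ i, Q (suTuple z i)) *
    ∏ i, ∏ j ∈ Finset.Ioi i, ‖(suTuple z i : ℂ) - (suTuple z j : ℂ)‖ ^ 2

/-- For `n = m + 1`, the normalization constant of the joint eigenvalue distribution of the
`n × n` special unitary random matrix associated with `Q`. -/
def suPartition (Q : Circle → ℝ) (m : ℕ) : ℝ≥0∞ :=
  ∫⁻ z : Fin m → Circle, ENNReal.ofReal (suWeight Q m z) ∂(Measure.pi fun _ => circleHaar)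

/-- For `n = m + 1`, the joint eigenvalue distribution on `𝕋^{n-1}` of the `n × n` special unitary
random matrix associated with `Q`. -/
def suEigenvalueLaw (Q : Circle → ℝ) (m : ℕ) : Measure (Fin m → Circle) :=
  (suPartition Q m)⁻¹ •
    (Measure.pi fun _ : Fin m => circleHaar).withDensity
      (fun z => ENNReal.ofReal (suWeight Q m z))

/-- The empirical distribution `(1/n) (δ_{ζ₁} + ⋯ + δ_{ζ_n})` of an `n`-tuple, `n = m + 1`. -/
def empiricalMeasure {m : ℕ} (ζ : Fin (m + 1) → Circle) : ProbabilityMeasure Circle :=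
  ⟨((m + 1 : ℕ) : ℝ≥0∞)⁻¹ • ∑ i, Measure.dirac (ζ i), ⟨by
    simp only [Measure.smul_apply, Measure.finsetSum_apply, measure_univ, Finset.sum_const,
      Finset.card_univ, Fintype.card_fin, smul_eq_mul, nsmul_eq_mul, mul_one]
    exact ENNReal.inv_mul_cancel (by simp) (ENNReal.natCast_ne_top _)⟩⟩

/-- The random elements `Y n` of `X`, defined on the probability spaces `(Ω n, P n)`, satisfy the
large deviation principle in the scale `ε n` with the (good) rate function `I : X → [0, ∞]`. -/
structure SatisfiesLDP {X : Type*} [TopologicalSpace X] {Ω : ℕ → Type*}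
    [∀ n, MeasurableSpace (Ω n)] (P : ∀ n, Measure (Ω n)) (Y : ∀ n, Ω n → X) (ε : ℕ → ℝ)
    (I : X → EReal) : Prop where
  isProbabilityMeasure : ∀ n, IsProbabilityMeasure (P n)
  measurableSet_preimage : ∀ n, ∀ G : Set X, IsOpen G → MeasurableSet (Y n ⁻¹' G)
  nonneg : ∀ x, 0 ≤ I x
  lowerSemicontinuous : LowerSemicontinuous I
  isCompact_sublevel : ∀ c : ℝ, IsCompact {x | I x ≤ (c : EReal)}
  upper_bound : ∀ F : Set X, IsClosed F →
    limsup (fun n => (ε n : EReal) * ENNReal.log (P n (Y n ⁻¹' F))) atTop ≤ -(⨅ x ∈ F, I x)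
  lower_bound : ∀ G : Set X, IsOpen G →
    -(⨅ x ∈ G, I x) ≤ liminf (fun n => (ε n : EReal) * ENNReal.log (P n (Y n ⁻¹' G))) atTop

end

open MeasureTheory Filter Topology ProbabilityTheory
open scoped ENNReal

noncomputable section

/-- The `k`-th moment `∫ ζ^k dμ` of a measure on the unit circle. -/
def circleMoment (k : ℕ) (μ : Measure Circle) : ℂ := ∫ ζ : Circle, (ζ : ℂ) ^ k ∂μ

/-- The logarithmic energy of a measure on the unit circle, as a sum over its moments. -/
def logEnergy (μ : Measure Circle) : ℝ≥0∞ :=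
  ∑' k : ℕ, ENNReal.ofReal (‖circleMoment (k + 1) μ‖ ^ 2 / (k + 1))

/-- The Abel regularisation of the logarithmic energy. -/
def abelEnergy (r : ℝ) (μ : Measure Circle) : ℝ :=
  ∑' k : ℕ, r ^ (k + 1) * (‖circleMoment (k + 1) μ‖ ^ 2 / (k + 1))

/-- A sequence of radii increasing to `1`. -/
def radius (N : ℕ) : ℝ := (N : ℝ) / (N + 1)

lemma radius_nonneg (N : ℕ) : 0 ≤ radius N := by unfold radius; positivity

lemma radius_lt_one (N : ℕ) : radius N < 1 := by
  unfold radius; rw [div_lt_one (by positivity)]; linarith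

lemma tendsto_radius : Tendsto radius atTop (𝓝 1) := tendsto_natCast_div_add_atTop (1 : ℝ)

lemma tendsto_log_two_div_radius :
    Tendsto (fun N => Real.log (2 / (1 + radius N))) atTop (𝓝 0) := by
  have h1 : Tendsto (fun N => Real.log (2 / (1 + radius N))) atTop
      (𝓝 (Real.log (2 / (1 + 1)))) := by
    refine Tendsto.log ?_ (by norm_num)
    exact tendsto_const_nhds.div (tendsto_const_nhds.add tendsto_radius) (by norm_num)
  norm_num at h1
  exact h1

lemma radius_monotone : Monotone radius := by
  refine monotone_nat_of_le_succ fun N => ?_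
  unfold radius
  rw [div_le_div_iff₀ (by positivity) (by positivity)]
  push_cast
  nlinarith

lemma one_sub_ne_zero_of_lt_one {r : ℝ} (h0 : 0 ≤ r) (h1 : r < 1) (w : Circle) :
    (1 - r * w : ℂ) ≠ 0 := by
  intro h
  have h2 : ‖(r * w : ℂ)‖ = 1 := by rw [← sub_eq_zero.1 h]; simp
  simp [abs_of_nonneg h0, Circle.norm_coe] at h2
  linarith

lemma hasSum_neg_log_norm_one_sub {r : ℝ} (h0 : 0 ≤ r) (h1 : r < 1) (w : Circle) :
    HasSum (fun k : ℕ => r ^ (k + 1) * (((w : ℂ) ^ (k + 1)).re / (k + 1)))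
      (-Real.log ‖(1 - r * w : ℂ)‖) := by
  have hz : ‖(r * w : ℂ)‖ < 1 := by simpa [abs_of_nonneg h0, Circle.norm_coe] using h1
  have h := Complex.hasSum_re (Complex.hasSum_taylorSeries_neg_log hz)
  rw [← hasSum_nat_add_iff' 1] at h
  simp only [Finset.range_one, Finset.sum_singleton, pow_zero, Nat.cast_zero, div_zero,
    Complex.zero_re, sub_zero, Complex.neg_re, Complex.log_re] at h
  have hterm : (fun k : ℕ => r ^ (k + 1) * (((w : ℂ) ^ (k + 1)).re / (k + 1))) =
      fun k : ℕ => ((r * w : ℂ) ^ (k + 1) / (k + 1 : ℕ)).re := funext fun k => ?_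
  · rw [hterm]; exact h
  rw [mul_pow, ← Complex.ofReal_pow, mul_div_assoc, Complex.re_ofReal_mul]
  congr 1
  rw [← Complex.ofReal_natCast, Complex.div_ofReal_re]
  push_cast; rfl

lemma norm_one_sub_sq (r : ℝ) (w : Circle) :
    ‖(1 - r * w : ℂ)‖ ^ 2 = 1 + r ^ 2 - 2 * r * (w : ℂ).re := by
  have hw : (w : ℂ).re ^ 2 + (w : ℂ).im ^ 2 = 1 := by
    have := Circle.normSq_coe w
    rw [Complex.normSq_apply] at this
    linarith
  rw [← Complex.normSq_eq_norm_sq, Complex.normSq_apply]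
  simp
  linear_combination r ^ 2 * hw

lemma norm_one_sub_le {r : ℝ} (h0 : 0 ≤ r) (w : Circle) :
    ‖(1 - w : ℂ)‖ ≤ 2 / (1 + r) * ‖(1 - r * w : ℂ)‖ := by
  have h1 := norm_one_sub_sq 1 w
  have h2 := norm_one_sub_sq r w
  have hw : -1 ≤ (w : ℂ).re := by
    have := Complex.abs_re_le_norm (w : ℂ)
    rw [Circle.norm_coe] at this
    exact (abs_le.1 this).1
  simp only [Complex.ofReal_one, one_mul] at h1
  refine abs_le_of_sq_le_sq' ?_ (by positivity) |>.2
  rw [mul_pow, div_pow, h1, h2, div_mul_eq_mul_div, le_div_iff₀ (by positivity)]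
  nlinarith [mul_nonneg (sq_nonneg (1 - r)) (by linarith : 0 ≤ 1 + (w : ℂ).re)]

lemma norm_one_sub_le_two {r : ℝ} (h0 : 0 ≤ r) (h1 : r ≤ 1) (w : Circle) :
    ‖(1 - r * w : ℂ)‖ ≤ 2 := by
  refine (norm_sub_le _ _).trans ?_
  simp [abs_of_nonneg h0, Circle.norm_coe]
  linarith

lemma norm_one_sub_div (ζ η : Circle) : ‖(1 - ((ζ / η : Circle) : ℂ))‖ = ‖(ζ : ℂ) - η‖ := by
  have : (1 - ((ζ / η : Circle) : ℂ)) = ((η : ℂ) - ζ) * ((η⁻¹ : Circle) : ℂ) := by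
    rw [div_eq_mul_inv, sub_mul, Circle.coe_mul, ← Circle.coe_mul η]
    simp
  rw [this, norm_mul, Circle.norm_coe, mul_one, norm_sub_rev]

lemma continuous_coe_div : Continuous fun p : Circle × Circle => ((p.1 / p.2 : Circle) : ℂ) :=
  (by fun_prop : Continuous fun z : Circle => (z : ℂ)).comp (continuous_fst.div' continuous_snd)

lemma integrable_of_continuous {X : Type*} [TopologicalSpace X] [CompactSpace X]
    [MeasurableSpace X] [OpensMeasurableSpace X] {E : Type*} [NormedAddCommGroup E]
    [SecondCountableTopology E] {μ : Measure X} [IsFiniteMeasure μ] {f : X → E} (hf : Continuous f) :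
    Integrable f μ := by
  borelize E
  obtain ⟨C, hC⟩ := isCompact_univ.exists_bound_of_continuousOn hf.continuousOn
  refine ⟨hf.measurable.aestronglyMeasurable, HasFiniteIntegral.of_bounded (C := C) ?_⟩
  exact Eventually.of_forall fun x => hC x trivial

lemma integral_re_div_pow (μ : Measure Circle) [IsProbabilityMeasure μ] (k : ℕ) :
    ∫ p : Circle × Circle, (((p.1 / p.2 : Circle) : ℂ) ^ k).re ∂(μ.prod μ) =
      ‖circleMoment k μ‖ ^ 2 := by
  have hint : Integrable (fun p : Circle × Circle => (((p.1 / p.2 : Circle) : ℂ) ^ k))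
      (μ.prod μ) := integrable_of_continuous (continuous_coe_div.pow k)
  have h1 := integral_re hint
  simp only [RCLike.re_eq_complex_re] at h1
  rw [h1]
  have h2 : ∀ p : Circle × Circle, (((p.1 / p.2 : Circle) : ℂ) ^ k) =
      (p.1 : ℂ) ^ k * (starRingEnd ℂ) ((p.2 : ℂ) ^ k) := by
    intro p
    rw [map_pow, ← Circle.coe_inv_eq_conj, div_eq_mul_inv, Circle.coe_mul, mul_pow]
  simp_rw [h2]
  rw [integral_prod_mul (fun ζ : Circle => (ζ : ℂ) ^ k)
    (fun η : Circle => (starRingEnd ℂ) ((η : ℂ) ^ k)), integral_conj, Complex.mul_conj]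
  rw [Complex.ofReal_re, Complex.normSq_eq_norm_sq]
  rfl

lemma norm_circleMoment_le (μ : Measure Circle) [IsProbabilityMeasure μ] (k : ℕ) :
    ‖circleMoment k μ‖ ≤ 1 := by
  refine (norm_integral_le_of_norm_le_const (C := 1) (Eventually.of_forall fun ζ => ?_)).trans ?_
  · simp [Circle.norm_coe]
  · simp

lemma div_succ_le_one {x : ℝ} (hx : x ≤ 1) (k : ℕ) : x / (k + 1) ≤ 1 := by
  rw [div_le_one (by positivity)]
  have : (0 : ℝ) ≤ k := by positivity
  linarith

lemma summable_pow_succ {r : ℝ} (h0 : 0 ≤ r) (h1 : r < 1) : Summable fun k : ℕ => r ^ (k + 1) :=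
  (summable_nat_add_iff 1).2 (summable_geometric_of_lt_one h0 h1)

lemma summable_abelEnergy {r : ℝ} (h0 : 0 ≤ r) (h1 : r < 1) (μ : Measure Circle)
    [IsProbabilityMeasure μ] :
    Summable fun k : ℕ => r ^ (k + 1) * (‖circleMoment (k + 1) μ‖ ^ 2 / (k + 1)) := by
  refine Summable.of_nonneg_of_le (fun k => by positivity) (fun k => ?_) (summable_pow_succ h0 h1)
  refine mul_le_of_le_one_right (by positivity) (div_succ_le_one ?_ k)
  exact pow_le_one₀ (norm_nonneg _) (norm_circleMoment_le μ _)

lemma continuous_log_norm_one_sub {r : ℝ} (h0 : 0 ≤ r) (h1 : r < 1) :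
    Continuous fun p : Circle × Circle =>
      Real.log ‖(1 - r * ((p.1 / p.2 : Circle) : ℂ))‖ := by
  refine Continuous.log
    (continuous_const.sub (continuous_const.mul continuous_coe_div)).norm fun p => ?_
  exact norm_ne_zero_iff.2 (one_sub_ne_zero_of_lt_one h0 h1 _)

lemma integral_neg_log_norm_one_sub {r : ℝ} (h0 : 0 ≤ r) (h1 : r < 1) (μ : Measure Circle)
    [IsProbabilityMeasure μ] :
    ∫ p : Circle × Circle, -Real.log ‖(1 - r * ((p.1 / p.2 : Circle) : ℂ))‖ ∂(μ.prod μ) =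
      abelEnergy r μ := by
  have hc : ∀ k : ℕ, Continuous fun p : Circle × Circle =>
      r ^ (k + 1) * ((((p.1 / p.2 : Circle) : ℂ) ^ (k + 1)).re / (k + 1)) := by
    intro k
    exact continuous_const.mul
      ((Complex.continuous_re.comp (continuous_coe_div.pow (k + 1))).div_const _)
  have hb : ∀ (k : ℕ) (p : Circle × Circle),
      ‖r ^ (k + 1) * ((((p.1 / p.2 : Circle) : ℂ) ^ (k + 1)).re / (k + 1))‖ ≤ r ^ (k + 1) := by
    intro k p
    rw [norm_mul, Real.norm_of_nonneg (by positivity)]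
    refine mul_le_of_le_one_right (by positivity) ?_
    rw [norm_div, Real.norm_of_nonneg (by positivity : (0 : ℝ) ≤ k + 1)]
    refine div_succ_le_one ?_ k
    refine (Complex.abs_re_le_norm _).trans ?_
    rw [norm_pow, Circle.norm_coe, one_pow]
  have h := hasSum_integral_of_summable_integral_norm (μ := μ.prod μ)
    (F := fun (k : ℕ) (p : Circle × Circle) =>
      r ^ (k + 1) * ((((p.1 / p.2 : Circle) : ℂ) ^ (k + 1)).re / (k + 1)))
    (fun k => integrable_of_continuous (hc k)) ?_
  · have h3 : ∀ k : ℕ, ∫ p : Circle × Circle,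
        r ^ (k + 1) * ((((p.1 / p.2 : Circle) : ℂ) ^ (k + 1)).re / (k + 1)) ∂(μ.prod μ) =
        r ^ (k + 1) * (‖circleMoment (k + 1) μ‖ ^ 2 / (k + 1)) := by
      intro k
      rw [integral_const_mul, integral_div, integral_re_div_pow]
    simp_rw [h3] at h
    rw [abelEnergy, h.tsum_eq]
    refine integral_congr_ae (Eventually.of_forall fun p => ?_)
    exact (hasSum_neg_log_norm_one_sub h0 h1 (p.1 / p.2)).tsum_eq.symm
  · refine Summable.of_nonneg_of_le (fun k => integral_nonneg fun _ => norm_nonneg _) (fun k => ?_)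
      (summable_pow_succ h0 h1)
    refine (integral_mono (integrable_of_continuous (hc k).norm) (integrable_const (r ^ (k + 1)))
      (hb k)).trans ?_
    simp

/-- The nonnegative kernel `log 2 - log |1 - r ζ/η|`. -/
def logKernel (r : ℝ) (p : Circle × Circle) : ℝ≥0∞ :=
  ((Real.log 2 : ℝ) - ENNReal.log ‖(1 - r * ((p.1 / p.2 : Circle) : ℂ))‖ₑ : EReal).toENNReal

lemma log_enorm {x : ℂ} (hx : x ≠ 0) : ENNReal.log ‖x‖ₑ = (Real.log ‖x‖ : ℝ) := by
  rw [← ofReal_norm, ENNReal.log_ofReal, if_neg]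
  simpa using hx

lemma logKernel_of_ne_zero {r : ℝ} {p : Circle × Circle}
    (h : (1 - r * ((p.1 / p.2 : Circle) : ℂ)) ≠ 0) :
    logKernel r p = ENNReal.ofReal (Real.log 2 - Real.log ‖(1 - r * ((p.1 / p.2 : Circle) : ℂ))‖) := by
  rw [logKernel, log_enorm h, ← EReal.coe_sub, EReal.real_coe_toENNReal]

lemma continuous_sub_log : Continuous fun x : ℝ≥0∞ =>
    ((Real.log 2 : ℝ) - ENNReal.log x : EReal).toENNReal := by
  refine EReal.continuous_toENNReal.comp ?_
  refine continuous_iff_continuousAt.2 fun x => ?_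
  have h1 : ContinuousAt (fun p : EReal × EReal => p.1 + p.2)
      ((Real.log 2 : ℝ), -ENNReal.log x) :=
    EReal.continuousAt_add (Or.inl (EReal.coe_ne_top _)) (Or.inl (EReal.coe_ne_bot _))
  have h2 : ContinuousAt (fun x : ℝ≥0∞ => (((Real.log 2 : ℝ) : EReal), -ENNReal.log x)) x :=
    continuousAt_const.prodMk (ENNReal.continuous_log.neg).continuousAt
  exact ContinuousAt.comp (f := fun x : ℝ≥0∞ => (((Real.log 2 : ℝ) : EReal), -ENNReal.log x)) h1 h2

lemma continuous_logKernel (r : ℝ) : Continuous (logKernel r) :=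
  continuous_sub_log.comp
    (continuous_const.sub (continuous_const.mul continuous_coe_div)).enorm

lemma tendsto_logKernel (p : Circle × Circle) :
    Tendsto (fun N => logKernel (radius N) p) atTop (𝓝 (logKernel 1 p)) := by
  refine (continuous_sub_log.tendsto _).comp ?_
  have : Continuous fun r : ℝ => ‖(1 - r * ((p.1 / p.2 : Circle) : ℂ))‖ₑ := by fun_prop
  exact (this.tendsto 1).comp tendsto_radius

lemma abelEnergy_nonneg {r : ℝ} (h0 : 0 ≤ r) (μ : Measure Circle) : 0 ≤ abelEnergy r μ :=
  tsum_nonneg fun k => by positivity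

lemma lintegral_logKernel {r : ℝ} (h0 : 0 ≤ r) (h1 : r < 1) (μ : Measure Circle)
    [IsProbabilityMeasure μ] :
    ∫⁻ p, logKernel r p ∂(μ.prod μ) = ENNReal.ofReal (Real.log 2 + abelEnergy r μ) := by
  have hne : ∀ p : Circle × Circle, (1 - r * ((p.1 / p.2 : Circle) : ℂ)) ≠ 0 := fun p =>
    one_sub_ne_zero_of_lt_one h0 h1 _
  simp_rw [fun p : Circle × Circle => logKernel_of_ne_zero (hne p)]
  have hi := integrable_of_continuous (μ := μ.prod μ) (continuous_log_norm_one_sub h0 h1)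
  rw [← ofReal_integral_eq_lintegral_ofReal]
  · rw [← integral_neg_log_norm_one_sub h0 h1, integral_sub (integrable_const _) hi, integral_neg]
    simp [sub_eq_add_neg]
  · exact (integrable_const _).sub hi
  · refine Eventually.of_forall fun p => sub_nonneg.2 ?_
    exact Real.log_le_log (norm_pos_iff.2 (hne p)) (norm_one_sub_le_two h0 h1.le _)

lemma logKernel_le {r : ℝ} (h0 : 0 ≤ r) (h1 : r < 1) (p : Circle × Circle) :
    logKernel r p ≤ logKernel 1 p + ENNReal.ofReal (Real.log (2 / (1 + r))) := by
  have hne := one_sub_ne_zero_of_lt_one h0 h1 (p.1 / p.2)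
  by_cases h : (1 - (1 : ℝ) * ((p.1 / p.2 : Circle) : ℂ)) = 0
  · have : logKernel 1 p = ⊤ := by
      rw [logKernel, h]
      simp
    simp [this]
  rw [logKernel_of_ne_zero hne, logKernel_of_ne_zero h]
  refine (ENNReal.ofReal_le_ofReal ?_).trans ENNReal.ofReal_add_le
  have h2 := norm_one_sub_le h0 (p.1 / p.2)
  rw [Complex.ofReal_one, one_mul] at h ⊢
  have h3 := Real.log_le_log (norm_pos_iff.2 h) h2
  rw [Real.log_mul (by positivity) (norm_ne_zero_iff.2 hne)] at h3
  linarith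

lemma ofReal_abelEnergy {r : ℝ} (h0 : 0 ≤ r) (h1 : r < 1) (μ : Measure Circle)
    [IsProbabilityMeasure μ] : ENNReal.ofReal (abelEnergy r μ) =
      ∑' k : ℕ, ENNReal.ofReal (r ^ (k + 1) * (‖circleMoment (k + 1) μ‖ ^ 2 / (k + 1))) :=
  ENNReal.ofReal_tsum_of_nonneg (fun k => by positivity) (summable_abelEnergy h0 h1 μ)

lemma lintegral_logKernel_one (μ : Measure Circle) [IsProbabilityMeasure μ] :
    ∫⁻ p, logKernel 1 p ∂(μ.prod μ) = ENNReal.ofReal (Real.log 2) + logEnergy μ := by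
  have hlog2 : 0 ≤ Real.log 2 := Real.log_nonneg (by norm_num)
  apply le_antisymm
  · calc ∫⁻ p, logKernel 1 p ∂(μ.prod μ)
        = ∫⁻ p, liminf (fun N => logKernel (radius N) p) atTop ∂(μ.prod μ) :=
          lintegral_congr fun p => (tendsto_logKernel p).liminf_eq.symm
      _ ≤ liminf (fun N => ∫⁻ p, logKernel (radius N) p ∂(μ.prod μ)) atTop :=
          lintegral_liminf_le fun N => (continuous_logKernel _).measurable
      _ ≤ ENNReal.ofReal (Real.log 2) + logEnergy μ := by
          refine liminf_le_of_le (by isBoundedDefault) fun b hb => ?_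
          obtain ⟨N, hN⟩ := hb.exists
          refine hN.trans ?_
          rw [lintegral_logKernel (radius_nonneg N) (radius_lt_one N),
            ENNReal.ofReal_add hlog2 (abelEnergy_nonneg (radius_nonneg N) μ),
            ofReal_abelEnergy (radius_nonneg N) (radius_lt_one N)]
          gcongr
          refine ENNReal.tsum_le_tsum fun k => ENNReal.ofReal_le_ofReal ?_
          exact mul_le_of_le_one_left (by positivity)
            (pow_le_one₀ (radius_nonneg N) (radius_lt_one N).le)
  · have key : ∀ N, ENNReal.ofReal (Real.log 2) + ENNReal.ofReal (abelEnergy (radius N) μ) ≤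
        ∫⁻ p, logKernel 1 p ∂(μ.prod μ) + ENNReal.ofReal (Real.log (2 / (1 + radius N))) := by
      intro N
      rw [← ENNReal.ofReal_add hlog2 (abelEnergy_nonneg (radius_nonneg N) μ),
        ← lintegral_logKernel (radius_nonneg N) (radius_lt_one N)]
      refine (lintegral_mono (logKernel_le (radius_nonneg N) (radius_lt_one N))).trans ?_
      rw [lintegral_add_right _ measurable_const]
      simp
    have hlim : Tendsto (fun N => ∫⁻ p, logKernel 1 p ∂(μ.prod μ) +
        ENNReal.ofReal (Real.log (2 / (1 + radius N)))) atTop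
        (𝓝 (∫⁻ p, logKernel 1 p ∂(μ.prod μ) + 0)) := by
      refine tendsto_const_nhds.add ?_
      simpa using ENNReal.tendsto_ofReal tendsto_log_two_div_radius
    rw [add_zero] at hlim
    rw [logEnergy, ENNReal.tsum_eq_iSup_nat, ENNReal.add_iSup]
    refine iSup_le fun K => ?_
    have hlim2 : Tendsto (fun N => ENNReal.ofReal (Real.log 2) + ∑ k ∈ Finset.range K,
        ENNReal.ofReal (radius N ^ (k + 1) * (‖circleMoment (k + 1) μ‖ ^ 2 / (k + 1)))) atTop
        (𝓝 (ENNReal.ofReal (Real.log 2) + ∑ k ∈ Finset.range K,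
          ENNReal.ofReal (‖circleMoment (k + 1) μ‖ ^ 2 / (k + 1)))) := by
      refine tendsto_const_nhds.add (tendsto_finsetSum _ fun k _ => ENNReal.tendsto_ofReal ?_)
      simpa using (tendsto_radius.pow (k + 1)).mul_const (‖circleMoment (k + 1) μ‖ ^ 2 / (k + 1))
    refine le_of_tendsto_of_tendsto' hlim2 hlim fun N => le_trans ?_ (key N)
    rw [ofReal_abelEnergy (radius_nonneg N) (radius_lt_one N)]
    gcongr
    exact ENNReal.sum_le_tsum _

lemma freeEntropy_eq (μ : ProbabilityMeasure Circle) :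
    freeEntropy μ = -(logEnergy (μ : Measure Circle) : EReal) := by
  have hlog2 : 0 ≤ Real.log 2 := Real.log_nonneg (by norm_num)
  set ρ := (μ : Measure Circle).prod (μ : Measure Circle)
  set f : Circle × Circle → EReal := fun p => ENNReal.log ‖(p.1 : ℂ) - (p.2 : ℂ)‖ₑ
  have hf : ∀ p, logKernel 1 p = ((Real.log 2 : ℝ) - f p : EReal).toENNReal := by
    intro p
    have := norm_one_sub_div p.1 p.2
    simp only [logKernel, Complex.ofReal_one, one_mul, f]
    rw [← ofReal_norm, this, ofReal_norm]
  have hfle : ∀ p, f p ≤ (Real.log 2 : ℝ) := by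
    intro p
    have h2 : ‖(p.1 : ℂ) - (p.2 : ℂ)‖ₑ ≤ ENNReal.ofReal 2 := by
      rw [← ofReal_norm]
      refine ENNReal.ofReal_le_ofReal ((norm_sub_le _ _).trans ?_)
      rw [Circle.norm_coe, Circle.norm_coe]; norm_num
    have := ENNReal.log_monotone h2
    rw [ENNReal.log_ofReal, if_neg (by norm_num)] at this
    exact this
  have hpt : ∀ p, logKernel 1 p + (f p).toENNReal =
      ENNReal.ofReal (Real.log 2) + (-f p).toENNReal := by
    intro p
    rw [hf]
    have h1 := hfle p
    induction hx : f p with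
    | bot => simp
    | top => rw [hx] at h1; simp at h1
    | coe x =>
      rw [hx, EReal.coe_le_coe_iff] at h1
      rw [← EReal.coe_sub, ← EReal.coe_neg]
      simp only [EReal.real_coe_toENNReal]
      rcases le_total 0 x with h | h
      · rw [ENNReal.ofReal_of_nonpos (neg_nonpos.2 h), ← ENNReal.ofReal_add (by linarith) h]
        simp
      · rw [ENNReal.ofReal_of_nonpos h, ← ENNReal.ofReal_add hlog2 (by linarith)]
        simp [sub_eq_add_neg]
  have hm : Measurable f := (ENNReal.continuous_log.comp (by fun_prop)).measurable
  have hint : ∫⁻ p, logKernel 1 p ∂ρ + ∫⁻ p, (f p).toENNReal ∂ρ =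
      ENNReal.ofReal (Real.log 2) + ∫⁻ p, (-f p).toENNReal ∂ρ := by
    rw [← lintegral_add_left (continuous_logKernel 1).measurable, lintegral_congr hpt,
      lintegral_add_left measurable_const]
    simp [ρ]
  rw [lintegral_logKernel_one, add_assoc, ENNReal.add_right_inj ENNReal.ofReal_ne_top] at hint
  have hfin : ∫⁻ p, (f p).toENNReal ∂ρ ≠ ⊤ := by
    refine ne_top_of_le_ne_top (b := ENNReal.ofReal (Real.log 2)) ENNReal.ofReal_ne_top ?_
    refine (lintegral_mono fun p => EReal.toENNReal_le_toENNReal (hfle p)).trans ?_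
    simp [ρ]
  rw [freeEntropy, extIntegral]
  change ((∫⁻ p, (f p).toENNReal ∂ρ : ℝ≥0∞) : EReal) - ((∫⁻ p, (-f p).toENNReal ∂ρ : ℝ≥0∞) : EReal)
    = _
  rw [← hint]
  lift ∫⁻ p, (f p).toENNReal ∂ρ to NNReal using hfin with b
  induction logEnergy (μ : Measure Circle) with
  | top => simp
  | coe a =>
    rw [← ENNReal.coe_add]
    change ((b : ℝ) : EReal) - (((a + b : NNReal) : ℝ) : EReal) = -((a : ℝ) : EReal)
    rw [NNReal.coe_add, ← EReal.coe_sub, ← EReal.coe_neg]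
    exact congrArg _ (by ring)

lemma continuous_integral_probabilityMeasure {𝕜 : Type*} [RCLike 𝕜] {f : Circle → 𝕜}
    (hf : Continuous f) :
    Continuous fun μ : ProbabilityMeasure Circle => ∫ ζ, f ζ ∂(μ : Measure Circle) := by
  refine continuous_iff_continuousAt.2 fun μ => ?_
  exact (ProbabilityMeasure.tendsto_iff_forall_integral_rclike_tendsto 𝕜).1 tendsto_id
    (BoundedContinuousFunction.mkOfCompact ⟨f, hf⟩)

lemma continuous_circleMoment (k : ℕ) :
    Continuous fun μ : ProbabilityMeasure Circle => circleMoment k (μ : Measure Circle) :=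
  continuous_integral_probabilityMeasure (by fun_prop)

/-- Finite truncations of the logarithmic energy. -/
def truncEnergy (N : ℕ) (μ : Measure Circle) : ℝ :=
  ∑ k ∈ Finset.range N, radius N ^ (k + 1) * (‖circleMoment (k + 1) μ‖ ^ 2 / (k + 1))

lemma continuous_truncEnergy (N : ℕ) :
    Continuous fun μ : ProbabilityMeasure Circle => truncEnergy N (μ : Measure Circle) := by
  refine continuous_finsetSum _ fun k _ => ?_
  exact continuous_const.mul (((continuous_circleMoment (k + 1)).norm.pow 2).div_const _)

lemma truncEnergy_nonneg (N : ℕ) (μ : Measure Circle) : 0 ≤ truncEnergy N μ :=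
  Finset.sum_nonneg fun k _ => mul_nonneg (pow_nonneg (radius_nonneg N) _) (by positivity)

lemma truncEnergy_mono (μ : Measure Circle) : Monotone fun N => truncEnergy N μ := by
  intro N M h
  have h1 : truncEnergy N μ ≤ ∑ k ∈ Finset.range N,
      radius M ^ (k + 1) * (‖circleMoment (k + 1) μ‖ ^ 2 / (k + 1)) := by
    refine Finset.sum_le_sum fun k _ => ?_
    have := pow_le_pow_left₀ (radius_nonneg N) (radius_monotone h) (k + 1)
    gcongr
  refine h1.trans (Finset.sum_le_sum_of_subset_of_nonneg (by simpa using h) fun k _ _ => ?_)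
  exact mul_nonneg (pow_nonneg (radius_nonneg M) _) (by positivity)

lemma truncEnergy_le_abelEnergy (N : ℕ) (μ : Measure Circle) [IsProbabilityMeasure μ] :
    truncEnergy N μ ≤ abelEnergy (radius N) μ :=
  (summable_abelEnergy (radius_nonneg N) (radius_lt_one N) μ).sum_le_tsum _ fun k _ =>
    mul_nonneg (pow_nonneg (radius_nonneg N) _) (by positivity)

lemma ofReal_truncEnergy (N : ℕ) (μ : Measure Circle) :
    ENNReal.ofReal (truncEnergy N μ) = ∑ k ∈ Finset.range N,
      ENNReal.ofReal (radius N ^ (k + 1) * (‖circleMoment (k + 1) μ‖ ^ 2 / (k + 1))) :=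
  ENNReal.ofReal_sum_of_nonneg fun k _ =>
    mul_nonneg (pow_nonneg (radius_nonneg N) _) (by positivity)

lemma ofReal_truncEnergy_le (N : ℕ) (μ : Measure Circle) :
    ENNReal.ofReal (truncEnergy N μ) ≤ logEnergy μ := by
  rw [ofReal_truncEnergy]
  refine le_trans (Finset.sum_le_sum fun k _ => ENNReal.ofReal_le_ofReal ?_)
    (ENNReal.sum_le_tsum (Finset.range N))
  exact mul_le_of_le_one_left (by positivity)
    (pow_le_one₀ (radius_nonneg N) (radius_lt_one N).le)

lemma exists_lt_truncEnergy {μ : Measure Circle} {a : ℝ≥0∞} (h : a < logEnergy μ) :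
    ∃ N, a < ENNReal.ofReal (truncEnergy N μ) := by
  rw [logEnergy, ENNReal.tsum_eq_iSup_nat] at h
  obtain ⟨K, hK⟩ := lt_iSup_iff.1 h
  have hlim : Tendsto (fun N => ∑ k ∈ Finset.range K,
      ENNReal.ofReal (radius N ^ (k + 1) * (‖circleMoment (k + 1) μ‖ ^ 2 / (k + 1)))) atTop
      (𝓝 (∑ k ∈ Finset.range K, ENNReal.ofReal (‖circleMoment (k + 1) μ‖ ^ 2 / (k + 1)))) := by
    refine tendsto_finsetSum _ fun k _ => ENNReal.tendsto_ofReal ?_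
    simpa using (tendsto_radius.pow (k + 1)).mul_const (‖circleMoment (k + 1) μ‖ ^ 2 / (k + 1))
  obtain ⟨N, hN, hKN⟩ := ((hlim.eventually (lt_mem_nhds hK)).and (eventually_ge_atTop K)).exists
  refine ⟨N, hN.trans_le ?_⟩
  rw [ofReal_truncEnergy]
  exact Finset.sum_le_sum_of_subset (by simpa using hKN)

/-- The weighted logarithmic energy `-Σ(μ) + ∫ Q dμ`. -/
def weightedEnergy (Q : Circle → ℝ) (μ : ProbabilityMeasure Circle) : EReal :=
  (logEnergy (μ : Measure Circle) : EReal) + ((∫ ζ, Q ζ ∂(μ : Measure Circle) : ℝ) : EReal)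

/-- Continuous truncations of the weighted logarithmic energy. -/
def truncWeightedEnergy (Q : Circle → ℝ) (N : ℕ) (μ : ProbabilityMeasure Circle) : ℝ :=
  truncEnergy N (μ : Measure Circle) + ∫ ζ, Q ζ ∂(μ : Measure Circle)

lemma relFreeEntropy_eq (Q : Circle → ℝ) (B : ℝ) (μ : ProbabilityMeasure Circle) :
    relFreeEntropy Q B μ = weightedEnergy Q μ + (B : EReal) := by
  rw [relFreeEntropy, freeEntropy_eq, neg_neg, weightedEnergy]

lemma truncWeightedEnergy_le (Q : Circle → ℝ) (N : ℕ) (μ : ProbabilityMeasure Circle) :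
    (truncWeightedEnergy Q N μ : EReal) ≤ weightedEnergy Q μ := by
  rw [truncWeightedEnergy, EReal.coe_add, weightedEnergy]
  gcongr
  have := EReal.coe_ennreal_le_coe_ennreal_iff.2 (ofReal_truncEnergy_le N (μ : Measure Circle))
  rwa [EReal.coe_ennreal_ofReal, max_eq_left (truncEnergy_nonneg N _)] at this

lemma truncWeightedEnergy_mono (Q : Circle → ℝ) (μ : ProbabilityMeasure Circle) :
    Monotone fun N => truncWeightedEnergy Q N μ := fun N M h => by
  have := truncEnergy_mono (μ : Measure Circle) h
  simp only [truncWeightedEnergy]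
  linarith

lemma continuous_truncWeightedEnergy {Q : Circle → ℝ} (hQ : Continuous Q) (N : ℕ) :
    Continuous (truncWeightedEnergy Q N) :=
  (continuous_truncEnergy N).add (continuous_integral_probabilityMeasure hQ)

lemma exists_lt_truncWeightedEnergy {Q : Circle → ℝ} {μ : ProbabilityMeasure Circle} {c : ℝ}
    (h : (c : EReal) < weightedEnergy Q μ) : ∃ N, c < truncWeightedEnergy Q N μ := by
  set q := ∫ ζ, Q ζ ∂(μ : Measure Circle)
  by_cases hc : c < q
  · exact ⟨0, by simpa [truncWeightedEnergy, truncEnergy] using hc⟩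
  · have hcq : 0 ≤ c - q := by linarith
    have h1 : ENNReal.ofReal (c - q) < logEnergy (μ : Measure Circle) := by
      rw [← EReal.coe_ennreal_lt_coe_ennreal_iff, EReal.coe_ennreal_ofReal, max_eq_left hcq,
        EReal.coe_sub]
      refine EReal.sub_lt_of_lt_add ?_
      exact h
    obtain ⟨N, hN⟩ := exists_lt_truncEnergy h1
    refine ⟨N, ?_⟩
    rw [ENNReal.ofReal_lt_ofReal_iff_of_nonneg hcq] at hN
    simp only [truncWeightedEnergy]
    linarith

lemma lowerSemicontinuous_weightedEnergy {Q : Circle → ℝ} (hQ : Continuous Q) :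
    LowerSemicontinuous (weightedEnergy Q) := by
  intro μ c hc
  obtain ⟨x, hx1, hx2⟩ := EReal.lt_iff_exists_real_btwn.1 hc
  obtain ⟨N, hN⟩ := exists_lt_truncWeightedEnergy hx2
  filter_upwards [(continuous_truncWeightedEnergy hQ N).continuousAt.eventually (lt_mem_nhds hN)]
    with ν hν
  exact (hx1.trans (EReal.coe_lt_coe_iff.2 hν)).trans_le (truncWeightedEnergy_le Q N ν)

/-- A Dini type statement: over a closed set, the truncations eventually exceed every real number
below the infimum of the weighted energy. -/
lemma exists_forall_lt_truncWeightedEnergy {Q : Circle → ℝ} (hQ : Continuous Q)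
    {F : Set (ProbabilityMeasure Circle)} (hF : IsClosed F) {c : ℝ}
    (h : (c : EReal) < ⨅ μ ∈ F, weightedEnergy Q μ) : ∃ N, ∀ μ ∈ F, c < truncWeightedEnergy Q N μ := by
  obtain ⟨N, hN⟩ := hF.isCompact.elim_directed_cover
    (fun N : ℕ => {μ | c < truncWeightedEnergy Q N μ})
    (fun N => isOpen_lt continuous_const (continuous_truncWeightedEnergy hQ N))
    (fun μ hμ => Set.mem_iUnion.2 (exists_lt_truncWeightedEnergy (h.trans_le (iInf₂_le μ hμ))))
    (directed_of_isDirected_le fun N M hNM μ hμ =>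
      lt_of_lt_of_le hμ (truncWeightedEnergy_mono Q μ hNM))
  exact ⟨N, fun μ hμ => hN hμ⟩

lemma weightedEnergy_ne_bot (Q : Circle → ℝ) (μ : ProbabilityMeasure Circle) :
    weightedEnergy Q μ ≠ ⊥ := by
  refine ne_bot_of_gt (b := ((truncWeightedEnergy Q 0 μ - 1 : ℝ) : EReal)) ?_
  refine lt_of_lt_of_le (EReal.coe_lt_coe_iff.2 ?_) (truncWeightedEnergy_le Q 0 μ)
  linarith

lemma exists_minimizer_weightedEnergy {Q : Circle → ℝ} (hQ : Continuous Q) :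
    ∃ μ, ∀ ν, weightedEnergy Q μ ≤ weightedEnergy Q ν := by
  obtain ⟨μ, -, hμ⟩ := LowerSemicontinuousOn.exists_isMinOn (s := Set.univ)
    ⟨⟨Measure.dirac (1 : Circle), inferInstance⟩, trivial⟩ isCompact_univ
    ((lowerSemicontinuous_weightedEnergy hQ).lowerSemicontinuousOn _)
  exact ⟨μ, fun ν => hμ trivial⟩

lemma exists_zpow_of_mem_closure {g : BoundedContinuousFunction Circle ℂ}
    {e : BoundedContinuousFunction Circle ℂ} (he : ∀ ζ, e ζ = ζ)
    (hg : g ∈ Submonoid.closure ({e} ∪ star {e} : Set (BoundedContinuousFunction Circle ℂ))) :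
    ∃ n : ℤ, ∀ ζ, g ζ = (ζ : ℂ) ^ n := by
  induction hg using Submonoid.closure_induction with
  | mem x hx =>
    rcases hx with hx | hx
    · rw [Set.mem_singleton_iff] at hx
      exact ⟨1, fun ζ => by rw [hx, he, zpow_one]⟩
    · rw [Set.mem_star, Set.mem_singleton_iff] at hx
      refine ⟨-1, fun ζ => ?_⟩
      have h1 : star (x ζ) = ζ := by rw [← he ζ, ← hx]; rfl
      rw [← star_star (x ζ), h1, zpow_neg_one, ← Circle.coe_inv, Circle.coe_inv_eq_conj]
      rfl
  | one => exact ⟨0, fun ζ => by simp⟩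
  | mul x y _ _ hx hy =>
    obtain ⟨n, hn⟩ := hx
    obtain ⟨m, hm⟩ := hy
    refine ⟨n + m, fun ζ => ?_⟩
    rw [zpow_add₀ (Circle.coe_ne_zero ζ), ← hn, ← hm]
    rfl

/-- A probability measure on the circle is determined by its moments. -/
lemma eq_of_circleMoment_eq {μ ν : Measure Circle} [IsProbabilityMeasure μ]
    [IsProbabilityMeasure ν] (h : ∀ k : ℕ, circleMoment (k + 1) μ = circleMoment (k + 1) ν) :
    μ = ν := by
  have hnat : ∀ k : ℕ, ∫ ζ : Circle, (ζ : ℂ) ^ k ∂μ = ∫ ζ : Circle, (ζ : ℂ) ^ k ∂ν := by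
    rintro (_ | k)
    · simp
    · exact h k
  have hint : ∀ n : ℤ, ∫ ζ : Circle, (ζ : ℂ) ^ n ∂μ = ∫ ζ : Circle, (ζ : ℂ) ^ n ∂ν := by
    intro n
    obtain ⟨k, rfl | rfl⟩ := n.eq_nat_or_neg
    · simpa using hnat k
    · have : ∀ ζ : Circle, (ζ : ℂ) ^ (-(k : ℤ)) = (starRingEnd ℂ) ((ζ : ℂ) ^ k) := by
        intro ζ
        rw [map_pow, ← Circle.coe_inv_eq_conj, Circle.coe_inv, zpow_neg, inv_pow, zpow_natCast]
      simp_rw [this, integral_conj, hnat]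
  let e : BoundedContinuousFunction Circle ℂ :=
    BoundedContinuousFunction.mkOfCompact ⟨fun ζ => (ζ : ℂ), by fun_prop⟩
  refine ext_of_forall_mem_subalgebra_integral_eq_of_pseudoEMetric_complete_countable (𝕜 := ℂ)
    (A := StarAlgebra.adjoin ℂ {e}) ?_ ?_
  · intro x y hxy
    refine ⟨_, ⟨BoundedContinuousFunction.toContinuousMapStarₐ ℂ e,
      ⟨e, StarAlgebra.self_mem_adjoin_singleton ℂ e, rfl⟩, rfl⟩, ?_⟩
    exact fun hh => hxy (Circle.ext hh)
  · intro g hg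
    have hg' : g ∈ Submodule.span ℂ
        (Submonoid.closure ({e} ∪ star {e}) : Set (BoundedContinuousFunction Circle ℂ)) := by
      rw [← StarAlgebra.adjoin_eq_span]
      exact hg
    have hI : ∀ (g : BoundedContinuousFunction Circle ℂ) (ρ : Measure Circle)
        [IsProbabilityMeasure ρ], Integrable g ρ := fun g ρ _ => g.integrable ρ
    induction hg' using Submodule.span_induction with
    | mem x hx =>
      obtain ⟨n, hn⟩ := exists_zpow_of_mem_closure (fun ζ => rfl) hx
      simp_rw [hn, hint]
    | zero => simp
    | add x y hx hy hx' hy' =>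
      simp only [BoundedContinuousFunction.coe_add, Pi.add_apply]
      rw [integral_add (hI x μ) (hI y μ), integral_add (hI x ν) (hI y ν)]
      have memA : ∀ z ∈ Submodule.span ℂ
          (Submonoid.closure ({e} ∪ star {e}) : Set (BoundedContinuousFunction Circle ℂ)),
          z ∈ StarAlgebra.adjoin ℂ {e} := by
        intro z hz
        rw [← StarAlgebra.adjoin_eq_span] at hz
        exact hz
      rw [hx' (memA x hx), hy' (memA y hy)]
    | smul a x hx hx' =>
      simp only [BoundedContinuousFunction.coe_smul]
      have memA : x ∈ StarAlgebra.adjoin ℂ {e} := by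
        rw [← StarAlgebra.adjoin_eq_span] at hx
        exact hx
      rw [integral_smul, integral_smul, hx' memA]

/-- The midpoint of two probability measures. -/
def midMeasure (μ ν : ProbabilityMeasure Circle) : ProbabilityMeasure Circle :=
  ⟨(2 : ℝ≥0∞)⁻¹ • ((μ : Measure Circle) + ν), ⟨by
    simp only [Measure.smul_apply, Measure.add_apply, measure_univ, smul_eq_mul]
    rw [one_add_one_eq_two]
    exact ENNReal.inv_mul_cancel (by simp) (by simp)⟩⟩

lemma integral_midMeasure {E : Type*} [NormedAddCommGroup E] [NormedSpace ℝ E]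
    [SecondCountableTopology E] (μ ν : ProbabilityMeasure Circle)
    {f : Circle → E} (hf : Continuous f) :
    ∫ ζ, f ζ ∂(midMeasure μ ν : Measure Circle) =
      (2 : ℝ)⁻¹ • (∫ ζ, f ζ ∂(μ : Measure Circle) + ∫ ζ, f ζ ∂(ν : Measure Circle)) := by
  change ∫ ζ, f ζ ∂((2 : ℝ≥0∞)⁻¹ • ((μ : Measure Circle) + (ν : Measure Circle))) = _
  rw [integral_smul_measure, integral_add_measure (integrable_of_continuous hf)
    (integrable_of_continuous hf)]
  simp

lemma two_mul_logEnergy_midMeasure (μ ν : ProbabilityMeasure Circle) :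
    2 * logEnergy (midMeasure μ ν : Measure Circle) +
      ∑' k : ℕ, ENNReal.ofReal (‖circleMoment (k + 1) (μ : Measure Circle) -
        circleMoment (k + 1) (ν : Measure Circle)‖ ^ 2 / (2 * (k + 1))) =
      logEnergy (μ : Measure Circle) + logEnergy (ν : Measure Circle) := by
  simp only [logEnergy]
  rw [← ENNReal.tsum_mul_left, ← ENNReal.tsum_add, ← ENNReal.tsum_add]
  congr 1
  funext k
  have h1 : circleMoment (k + 1) (midMeasure μ ν : Measure Circle) = (2 : ℝ)⁻¹ •
      (circleMoment (k + 1) (μ : Measure Circle) + circleMoment (k + 1) (ν : Measure Circle)) :=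
    integral_midMeasure μ ν (by fun_prop)
  rw [h1]
  set a := circleMoment (k + 1) (μ : Measure Circle)
  set b := circleMoment (k + 1) (ν : Measure Circle)
  have h2 := parallelogram_law_with_norm ℝ a b
  rw [← ENNReal.ofReal_ofNat, ← ENNReal.ofReal_mul (by norm_num),
    ← ENNReal.ofReal_add (by positivity) (by positivity),
    ← ENNReal.ofReal_add (by positivity) (by positivity), norm_smul, mul_pow]
  congr 1
  rw [Real.norm_of_nonneg (by norm_num)]
  field_simp
  nlinarith

lemma weightedEnergy_minimizer_unique {Q : Circle → ℝ} (hQ : Continuous Q)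
    {μ ν : ProbabilityMeasure Circle} (hμ : ∀ ρ, weightedEnergy Q μ ≤ weightedEnergy Q ρ)
    (hν : ∀ ρ, weightedEnergy Q ν ≤ weightedEnergy Q ρ) (hfin : weightedEnergy Q μ ≠ ⊤) :
    ν = μ := by
  have heq : weightedEnergy Q ν = weightedEnergy Q μ := le_antisymm (hν μ) (hμ ν)
  have hmid := hμ (midMeasure μ ν)
  have hq := integral_midMeasure μ ν hQ
  have key := two_mul_logEnergy_midMeasure μ ν
  have htop : ∀ ρ, weightedEnergy Q ρ ≠ ⊤ → logEnergy (ρ : Measure Circle) ≠ ⊤ := by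
    intro ρ h1 h2
    exact h1 (by rw [weightedEnergy, h2]; simp)
  have h1 := htop μ hfin
  have h2 := htop ν (heq ▸ hfin)
  set D := ∑' k : ℕ, ENNReal.ofReal (‖circleMoment (k + 1) (μ : Measure Circle) -
        circleMoment (k + 1) (ν : Measure Circle)‖ ^ 2 / (2 * (k + 1))) with hD
  have hsum : logEnergy (μ : Measure Circle) + logEnergy (ν : Measure Circle) ≠ ⊤ :=
    ENNReal.add_ne_top.2 ⟨h1, h2⟩
  rw [← key] at hsum
  have h3 : logEnergy (midMeasure μ ν : Measure Circle) ≠ ⊤ := fun h => by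
    rw [h] at hsum; simp at hsum
  have hDfin := (ENNReal.add_ne_top.1 hsum).2
  simp only [weightedEnergy] at hmid heq
  rw [hq] at hmid
  have key' := congrArg ENNReal.toReal key
  rw [ENNReal.toReal_add (ENNReal.add_ne_top.1 hsum).1 hDfin, ENNReal.toReal_add h1 h2,
    ENNReal.toReal_mul] at key'
  rw [← EReal.coe_ennreal_toReal h1] at hmid heq
  rw [← EReal.coe_ennreal_toReal h3, ← EReal.coe_add, ← EReal.coe_add,
    EReal.coe_le_coe_iff] at hmid
  rw [← EReal.coe_ennreal_toReal h2, ← EReal.coe_add, ← EReal.coe_add,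
    EReal.coe_eq_coe_iff] at heq
  simp only [ENNReal.toReal_ofNat, smul_eq_mul] at key' hmid
  have hD0 : D.toReal ≤ 0 := by linarith
  have hDzero : D = 0 := by
    have := le_antisymm hD0 ENNReal.toReal_nonneg
    rcases (ENNReal.toReal_eq_zero_iff _).1 this with h | h
    · exact h
    · exact absurd h hDfin
  rw [hD, ENNReal.tsum_eq_zero] at hDzero
  refine (Subtype.ext (?_ : (μ : Measure Circle) = ν)).symm
  refine eq_of_circleMoment_eq fun k => ?_
  have h4 := hDzero k
  rw [ENNReal.ofReal_eq_zero] at h4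
  have h5 : ‖circleMoment (k + 1) (μ : Measure Circle) -
        circleMoment (k + 1) (ν : Measure Circle)‖ ^ 2 ≤ 0 := by
    rwa [div_le_iff₀ (by positivity), zero_mul] at h4
  exact sub_eq_zero.1 (norm_eq_zero.1 (pow_eq_zero_iff (two_ne_zero) |>.1
    (le_antisymm h5 (by positivity))))

lemma integral_empiricalMeasure {m : ℕ} (ζ : Fin (m + 1) → Circle) (f : Circle → ℝ) :
    ∫ x, f x ∂(empiricalMeasure ζ : Measure Circle) = ((m : ℝ) + 1)⁻¹ * ∑ i, f (ζ i) := by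
  change ∫ x, f x ∂(((m + 1 : ℕ) : ℝ≥0∞)⁻¹ • ∑ i, Measure.dirac (ζ i)) = _
  rw [integral_smul_measure, integral_finsetSum_measure fun i _ => integrable_dirac (by simp)]
  simp [ENNReal.toReal_inv, ENNReal.toReal_add]

lemma continuous_empiricalMeasure (m : ℕ) :
    Continuous (empiricalMeasure : (Fin (m + 1) → Circle) → ProbabilityMeasure Circle) := by
  refine continuous_iff_continuousAt.2 fun ζ => ?_
  refine ProbabilityMeasure.tendsto_iff_forall_integral_tendsto.2 fun f => ?_
  simp_rw [integral_empiricalMeasure]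
  have : Continuous fun ζ : Fin (m + 1) → Circle => ((m : ℝ) + 1)⁻¹ * ∑ i, f (ζ i) := by fun_prop
  exact this.continuousAt

lemma continuous_suTuple (m : ℕ) : Continuous (suTuple : (Fin m → Circle) → _) := by
  refine continuous_pi fun i => ?_
  refine Fin.lastCases ?_ (fun j => ?_) i
  · simp only [suTuple, Fin.snoc_last]
    fun_prop
  · simp only [suTuple, Fin.snoc_castSucc]
    fun_prop

lemma continuous_empiricalMeasure_suTuple (m : ℕ) :
    Continuous fun z : Fin m → Circle => empiricalMeasure (suTuple z) :=
  (continuous_empiricalMeasure m).comp (continuous_suTuple m)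

lemma continuous_suWeight {Q : Circle → ℝ} (hQ : Continuous Q) (m : ℕ) :
    Continuous (suWeight Q m) := by
  have h : ∀ i, Continuous fun z : Fin m → Circle => suTuple z i := fun i =>
    (continuous_apply i).comp (continuous_suTuple m)
  have hc : Continuous fun z : Circle => (z : ℂ) := by fun_prop
  refine (Real.continuous_exp.comp (continuous_const.mul
    (continuous_finsetSum _ fun i _ => hQ.comp (h i)))).mul ?_
  refine continuous_finsetProd _ fun i _ => continuous_finsetProd _ fun j _ => ?_
  exact ((hc.comp (h i)).sub (hc.comp (h j))).norm.pow 2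

lemma suWeight_nonneg (Q : Circle → ℝ) (m : ℕ) (z : Fin m → Circle) : 0 ≤ suWeight Q m z :=
  mul_nonneg (Real.exp_pos _).le
    (Finset.prod_nonneg fun _ _ => Finset.prod_nonneg fun _ _ => by positivity)

lemma sum_sum_Ioi_two_mul {n : ℕ} {b : Fin n → Fin n → ℝ} (hb : ∀ i j, b i j = b j i) :
    ∑ i, ∑ j ∈ Finset.Ioi i, 2 * b i j = ∑ i, ∑ j, b i j - ∑ i, b i i := by
  have h1 : ∑ i, ∑ j ∈ Finset.Iio i, b i j = ∑ i, ∑ j ∈ Finset.Ioi i, b i j := by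
    rw [Finset.sum_comm' (t' := Finset.univ) (s' := fun j => Finset.Ioi j) (by simp)]
    exact Finset.sum_congr rfl fun i _ => Finset.sum_congr rfl fun j _ => hb j i
  have h2 : ∀ i, ∑ j, b i j = ∑ j ∈ Finset.Iio i, b i j + b i i + ∑ j ∈ Finset.Ioi i, b i j := by
    intro i
    rw [← Finset.sum_filter_add_sum_filter_not Finset.univ (fun j => j ≤ i),
      show Finset.univ.filter (fun j => j ≤ i) = insert i (Finset.Iio i) by
        ext j; simp [le_iff_eq_or_lt],
      Finset.sum_insert (by simp), show Finset.univ.filter (fun j => ¬ j ≤ i) = Finset.Ioi i by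
        ext j; simp]
    ring
  simp_rw [h2, Finset.sum_add_distrib, h1, ← Finset.mul_sum]
  ring

lemma norm_one_sub_inv (r : ℝ) (w : Circle) :
    ‖(1 - r * ((w⁻¹ : Circle) : ℂ))‖ = ‖(1 - r * w : ℂ)‖ := by
  rw [Circle.coe_inv_eq_conj, ← Complex.norm_conj]
  simp

lemma abelEnergy_empiricalMeasure {r : ℝ} (h0 : 0 ≤ r) (h1 : r < 1) {m : ℕ}
    (ζ : Fin (m + 1) → Circle) :
    ((m : ℝ) + 1) ^ 2 * abelEnergy r (empiricalMeasure ζ : Measure Circle) =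
      -∑ i, ∑ j, Real.log ‖(1 - r * ((ζ i / ζ j : Circle) : ℂ))‖ := by
  rw [← integral_neg_log_norm_one_sub h0 h1, integral_neg, integral_prod _
    (integrable_of_continuous (continuous_log_norm_one_sub h0 h1))]
  simp_rw [integral_empiricalMeasure, ← Finset.mul_sum]
  have : (m : ℝ) + 1 ≠ 0 := by positivity
  field_simp

lemma prod_norm_sub_sq_le {r : ℝ} (h0 : 0 ≤ r) (h1 : r < 1) {m : ℕ} (ζ : Fin (m + 1) → Circle) :
    ∏ i, ∏ j ∈ Finset.Ioi i, ‖(ζ i : ℂ) - (ζ j : ℂ)‖ ^ 2 ≤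
      Real.exp (-((m : ℝ) + 1) ^ 2 * abelEnergy r (empiricalMeasure ζ : Measure Circle) +
        ((m : ℝ) + 1) ^ 2 * Real.log (2 / (1 + r)) - (m + 1) * Real.log (1 - r)) := by
  set c := Real.log (2 / (1 + r)) with hc
  have hc0 : 0 ≤ c := Real.log_nonneg (by rw [one_le_div (by linarith)]; linarith)
  set b : Fin (m + 1) → Fin (m + 1) → ℝ := fun i j =>
    Real.log ‖(1 - r * ((ζ i / ζ j : Circle) : ℂ))‖ + c
  have hb : ∀ i j, b i j = b j i := by
    intro i j
    simp only [b]
    rw [← norm_one_sub_inv, inv_div]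
  have hle : ∀ i j, ‖(ζ i : ℂ) - (ζ j : ℂ)‖ ^ 2 ≤ Real.exp (2 * b i j) := by
    intro i j
    rw [← norm_one_sub_div, two_mul, Real.exp_add, ← sq]
    refine pow_le_pow_left₀ (norm_nonneg _) ?_ 2
    rw [Real.exp_add, Real.exp_log (norm_pos_iff.2 (one_sub_ne_zero_of_lt_one h0 h1 _)),
      Real.exp_log (by positivity), mul_comm]
    exact norm_one_sub_le h0 _
  have hdiag : ∀ i, b i i = Real.log (1 - r) + c := by
    intro i
    simp only [b]
    rw [div_self', Circle.coe_one, mul_one, ← Complex.ofReal_one, ← Complex.ofReal_sub,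
      Complex.norm_real, Real.norm_of_nonneg (by linarith)]
  calc ∏ i, ∏ j ∈ Finset.Ioi i, ‖(ζ i : ℂ) - (ζ j : ℂ)‖ ^ 2
      ≤ ∏ i, ∏ j ∈ Finset.Ioi i, Real.exp (2 * b i j) :=
        Finset.prod_le_prod (fun i _ => Finset.prod_nonneg fun j _ => by positivity) fun i _ =>
          Finset.prod_le_prod (fun j _ => by positivity) fun j _ => hle i j
    _ = Real.exp (∑ i, ∑ j ∈ Finset.Ioi i, 2 * b i j) := by simp_rw [Real.exp_sum]
    _ ≤ _ := by
        refine Real.exp_le_exp.2 ?_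
        rw [sum_sum_Ioi_two_mul hb]
        simp_rw [hdiag, b, Finset.sum_add_distrib]
        simp only [Finset.sum_const, Finset.card_univ, Fintype.card_fin, nsmul_eq_mul]
        rw [neg_mul, abelEnergy_empiricalMeasure h0 h1]
        push_cast
        have : 0 ≤ ((m : ℝ) + 1) * c := by positivity
        nlinarith

lemma suWeight_le (Q : Circle → ℝ) (m N : ℕ) (z : Fin m → Circle) :
    suWeight Q m z ≤ Real.exp (((m : ℝ) + 1) ^ 2 *
      (-truncWeightedEnergy Q N (empiricalMeasure (suTuple z)) + Real.log (2 / (1 + radius N))) -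
        (m + 1) * Real.log (1 - radius N)) := by
  have h := prod_norm_sub_sq_le (radius_nonneg N) (radius_lt_one N) (suTuple z)
  have h2 := truncEnergy_le_abelEnergy N (empiricalMeasure (suTuple z) : Measure Circle)
  refine (mul_le_mul_of_nonneg_left h (Real.exp_pos _).le).trans ?_
  rw [← Real.exp_add]
  refine Real.exp_le_exp.2 ?_
  rw [truncWeightedEnergy, integral_empiricalMeasure]
  have h3 : ((m : ℝ) + 1) ^ 2 * (((m : ℝ) + 1)⁻¹ * ∑ i, Q (suTuple z i)) =
      ((m : ℝ) + 1) * ∑ i, Q (suTuple z i) := by field_simp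
  have h4 := mul_le_mul_of_nonneg_left h2 (by positivity : 0 ≤ ((m : ℝ) + 1) ^ 2)
  nlinarith

/-- The unnormalised mass of the tuples whose empirical measure lies in `A`. -/
def suMass (Q : Circle → ℝ) (m : ℕ) (A : Set (ProbabilityMeasure Circle)) : ℝ≥0∞ :=
  ∫⁻ z in (fun z : Fin m → Circle => empiricalMeasure (suTuple z)) ⁻¹' A,
    ENNReal.ofReal (suWeight Q m z) ∂(Measure.pi fun _ => circleHaar)

lemma suMass_univ (Q : Circle → ℝ) (m : ℕ) : suMass Q m Set.univ = suPartition Q m := by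
  simp [suMass, suPartition]

lemma log_ofReal_exp (x : ℝ) : ENNReal.log (ENNReal.ofReal (Real.exp x)) = (x : EReal) := by
  rw [ENNReal.log_ofReal, if_neg (not_le.2 (Real.exp_pos x)), Real.log_exp]

lemma log_suMass_le {Q : Circle → ℝ} {A : Set (ProbabilityMeasure Circle)} (hA : IsClosed A) {N : ℕ}
    {c : ℝ} (h : ∀ μ ∈ A, c < truncWeightedEnergy Q N μ) (m : ℕ) :
    (((1 : ℝ) / ((m : ℝ) + 1) ^ 2 : ℝ) : EReal) * ENNReal.log (suMass Q m A) ≤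
      ((-c + Real.log (2 / (1 + radius N)) - (1 / ((m : ℝ) + 1)) * Real.log (1 - radius N) : ℝ) :
        EReal) := by
  have h1 : suMass Q m A ≤ ENNReal.ofReal (Real.exp (((m : ℝ) + 1) ^ 2 *
      (-c + Real.log (2 / (1 + radius N))) - (m + 1) * Real.log (1 - radius N))) := by
    have hmeas : MeasurableSet ((fun z : Fin m → Circle => empiricalMeasure (suTuple z)) ⁻¹' A) :=
      (hA.preimage (continuous_empiricalMeasure_suTuple m)).measurableSet
    refine (setLIntegral_mono_ae' hmeas (g := fun _ => ENNReal.ofReal (Real.exp (((m : ℝ) + 1) ^ 2 *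
      (-c + Real.log (2 / (1 + radius N))) - (m + 1) * Real.log (1 - radius N))))
      (Eventually.of_forall fun z hz => ?_)).trans ?_
    · refine ENNReal.ofReal_le_ofReal ((suWeight_le Q m N z).trans (Real.exp_le_exp.2 ?_))
      have := (h _ hz).le
      gcongr
    · rw [setLIntegral_const]
      exact mul_le_of_le_one_right' prob_le_one
  have h2 := ENNReal.log_monotone h1
  rw [log_ofReal_exp] at h2
  refine (mul_le_mul_of_nonneg_left h2 (by exact_mod_cast (by positivity : (0:ℝ) ≤ 1 / ((m : ℝ) + 1) ^ 2))).trans (le_of_eq ?_)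
  rw [← EReal.coe_mul]
  congr 1
  have : (m : ℝ) + 1 ≠ 0 := by positivity
  field_simp

lemma limsup_log_suMass_le {Q : Circle → ℝ} (hQ : Continuous Q)
    {F : Set (ProbabilityMeasure Circle)} (hF : IsClosed F) :
    limsup (fun m : ℕ => (((1 : ℝ) / ((m : ℝ) + 1) ^ 2 : ℝ) : EReal) * ENNReal.log (suMass Q m F))
      atTop ≤ -⨅ μ ∈ F, weightedEnergy Q μ := by
  by_contra! hcon
  obtain ⟨x, hx1, hx2⟩ := EReal.lt_iff_exists_real_btwn.1 hcon
  have hx3 : ((-x : ℝ) : EReal) < ⨅ μ ∈ F, weightedEnergy Q μ := by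
    rw [EReal.coe_neg]
    exact EReal.neg_lt_comm.1 hx1
  obtain ⟨N₀, hN₀⟩ := exists_forall_lt_truncWeightedEnergy hQ hF hx3
  refine absurd hx2 (not_lt.2 ?_)
  have key : ∀ N ≥ N₀, limsup (fun m : ℕ => (((1 : ℝ) / ((m : ℝ) + 1) ^ 2 : ℝ) : EReal) *
      ENNReal.log (suMass Q m F)) atTop ≤ ((x + Real.log (2 / (1 + radius N)) : ℝ) : EReal) := by
    intro N hN
    have hlim : Tendsto (fun m : ℕ => x + Real.log (2 / (1 + radius N)) -
        (1 / ((m : ℝ) + 1)) * Real.log (1 - radius N)) atTop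
        (𝓝 (x + Real.log (2 / (1 + radius N)))) := by
      simpa using tendsto_const_nhds.sub
        (tendsto_one_div_add_atTop_nhds_zero_nat.mul_const (Real.log (1 - radius N)))
    have hlim' := (continuous_coe_real_ereal.tendsto _).comp hlim
    refine (limsup_le_limsup (Eventually.of_forall fun m => ?_)).trans_eq hlim'.limsup_eq
    have := log_suMass_le (c := -x) hF (fun μ hμ =>
      (hN₀ μ hμ).trans_le (truncWeightedEnergy_mono Q μ hN)) m
    rwa [neg_neg] at this
  have hlim : Tendsto (fun N => ((x + Real.log (2 / (1 + radius N)) : ℝ) : EReal)) atTop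
      (𝓝 ((x : ℝ) : EReal)) := by
    refine (continuous_coe_real_ereal.tendsto _).comp ?_
    simpa using tendsto_const_nhds.add tendsto_log_two_div_radius
  refine ge_of_tendsto hlim ?_
  filter_upwards [eventually_ge_atTop N₀] with N hN using key N hN

instance fact_two_pi_pos : Fact (0 < 2 * Real.pi) := ⟨Real.two_pi_pos⟩

lemma circleHaar_eq_map_addCircle : circleHaar = ENNReal.ofReal (2 * Real.pi)⁻¹ •
    (volume : Measure (AddCircle (2 * Real.pi))).map AddCircle.homeomorphCircle' := by
  have h := AddCircle.measurePreserving_mk (2 * Real.pi) (-Real.pi)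
  rw [show -Real.pi + 2 * Real.pi = Real.pi by ring] at h
  rw [circleHaar, restrict_Ico_eq_restrict_Ioc, ← h.map_eq,
    Measure.map_map AddCircle.homeomorphCircle'.continuous.measurable h.measurable]
  rfl

instance isMulLeftInvariant_circleHaar : circleHaar.IsMulLeftInvariant := by
  refine ⟨fun g => ?_⟩
  have hm : Measurable AddCircle.homeomorphCircle' :=
    AddCircle.homeomorphCircle'.continuous.measurable
  obtain ⟨a, rfl⟩ := AddCircle.homeomorphCircle'.surjective g
  rw [circleHaar_eq_map_addCircle, Measure.map_smul,
    Measure.map_map (measurable_const_mul _) hm]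
  have : (fun x : Circle => AddCircle.homeomorphCircle' a * x) ∘ AddCircle.homeomorphCircle' =
      AddCircle.homeomorphCircle' ∘ fun x : AddCircle (2 * Real.pi) => a + x := by
    funext x
    exact (Real.Angle.toCircle_add a x).symm
  rw [this, ← Measure.map_map hm (measurable_const_add a), map_add_left_eq_self]

instance isOpenPosMeasure_circleHaar : circleHaar.IsOpenPosMeasure :=
  isOpenPosMeasure_of_mulLeftInvariant_of_compact Set.univ isCompact_univ (by simp)

lemma circleMoment_circleHaar (k : ℕ) : circleMoment (k + 1) circleHaar = 0 := by
  set g : Circle := Circle.exp (Real.pi / (k + 1))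
  have hg : (g : ℂ) ^ (k + 1) = -1 := by
    have h1 : ((k + 1) • (Real.pi / (k + 1)) : ℝ) = Real.pi := by
      rw [nsmul_eq_mul]; push_cast; field_simp
    rw [← Circle.coe_pow, ← Circle.exp_nsmul, h1, Circle.coe_exp, Complex.exp_pi_mul_I]
  have h := integral_mul_left_eq_self (μ := circleHaar) (fun ζ : Circle => (ζ : ℂ) ^ (k + 1)) g
  simp_rw [Circle.coe_mul, mul_pow, hg, integral_const_mul] at h
  change -1 * circleMoment (k + 1) circleHaar = circleMoment (k + 1) circleHaar at h
  linear_combination (-1 / 2) * h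

lemma logEnergy_circleHaar : logEnergy circleHaar = 0 := by
  simp [logEnergy, circleMoment_circleHaar]

/-- The kernel `log 2 - log |1 - w|` of one variable. -/
def circleKernel (w : Circle) : ℝ≥0∞ := logKernel 1 (w, 1)

lemma logKernel_one_eq (ζ η : Circle) : logKernel 1 (ζ, η) = circleKernel (ζ / η) := by
  simp [circleKernel, logKernel]

lemma measurable_circleKernel : Measurable circleKernel :=
  ((continuous_logKernel 1).comp (by fun_prop : Continuous fun w : Circle => (w, (1 : Circle)))).measurable

lemma circleKernel_one : circleKernel 1 = ⊤ := by
  simp [circleKernel, logKernel]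

lemma circleKernel_of_ne_one {w : Circle} (hw : w ≠ 1) :
    circleKernel w = ENNReal.ofReal (Real.log 2 - Real.log ‖(1 - w : ℂ)‖) := by
  have h : (1 - (1 : ℝ) * (((w, (1 : Circle)).1 / (w, (1 : Circle)).2 : Circle) : ℂ)) ≠ 0 := by
    simp only [Complex.ofReal_one, one_mul, div_one]
    intro h
    exact hw (Circle.ext (by simpa using (sub_eq_zero.1 h).symm))
  rw [circleKernel, logKernel_of_ne_zero h]
  simp

lemma log_norm_one_sub_le (w : Circle) : Real.log ‖(1 - w : ℂ)‖ ≤ Real.log 2 := by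
  by_cases h : ‖(1 - w : ℂ)‖ = 0
  · rw [h, Real.log_zero]
    exact Real.log_nonneg (by norm_num)
  · refine Real.log_le_log (lt_of_le_of_ne (norm_nonneg _) (Ne.symm h)) ?_
    simpa using norm_one_sub_le_two zero_le_one le_rfl w

lemma measurable_log_norm_one_sub : Measurable fun w : Circle => Real.log ‖(1 - w : ℂ)‖ :=
  Real.measurable_log.comp (by fun_prop : Continuous fun w : Circle => ‖(1 - w : ℂ)‖).measurable

lemma lintegral_circleKernel_circleHaar :
    ∫⁻ w, circleKernel w ∂circleHaar = ENNReal.ofReal (Real.log 2) := by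
  have h := lintegral_logKernel_one circleHaar
  rw [logEnergy_circleHaar, add_zero,
    lintegral_prod_symm' _ (continuous_logKernel 1).measurable] at h
  simp_rw [logKernel_one_eq, div_eq_mul_inv, lintegral_mul_right_eq_self] at h
  simpa using h

section Laws

variable {Ω : Type*} [MeasurableSpace Ω] {P : Measure Ω} {X : Ω → Circle}

lemma ae_ne_one_of_lintegral_circleKernel (hX : Measurable X)
    (h : ∫⁻ ω, circleKernel (X ω) ∂P ≠ ⊤) : ∀ᵐ ω ∂P, X ω ≠ 1 := by
  filter_upwards [ae_lt_top (measurable_circleKernel.comp hX) h] with ω hω h1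
  rw [Function.comp_apply, h1, circleKernel_one] at hω
  exact lt_irrefl _ hω

lemma integrable_log_of_lintegral_circleKernel [IsProbabilityMeasure P] (hX : Measurable X)
    (h : ∫⁻ ω, circleKernel (X ω) ∂P ≠ ⊤) :
    Integrable (fun ω => Real.log ‖(1 - X ω : ℂ)‖) P ∧
      ∫ ω, Real.log ‖(1 - X ω : ℂ)‖ ∂P =
        Real.log 2 - (∫⁻ ω, circleKernel (X ω) ∂P).toReal := by
  have hm : Measurable fun ω => Real.log ‖(1 - X ω : ℂ)‖ := measurable_log_norm_one_sub.comp hX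
  have hnn : 0 ≤ᵐ[P] fun ω => Real.log 2 - Real.log ‖(1 - X ω : ℂ)‖ :=
    Eventually.of_forall fun ω => sub_nonneg.2 (log_norm_one_sub_le _)
  have heq : ∫⁻ ω, circleKernel (X ω) ∂P =
      ∫⁻ ω, ENNReal.ofReal (Real.log 2 - Real.log ‖(1 - X ω : ℂ)‖) ∂P := by
    refine lintegral_congr_ae ?_
    filter_upwards [ae_ne_one_of_lintegral_circleKernel hX h] with ω hω
    exact circleKernel_of_ne_one hω
  have hi : Integrable (fun ω => Real.log 2 - Real.log ‖(1 - X ω : ℂ)‖) P := by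
    rw [← lintegral_ofReal_ne_top_iff_integrable (hm.const_sub _).aestronglyMeasurable hnn, ← heq]
    exact h
  have hi2 : Integrable (fun ω => Real.log ‖(1 - X ω : ℂ)‖) P := by
    refine ((integrable_const (Real.log 2)).sub hi).congr (Eventually.of_forall fun ω => ?_)
    exact sub_sub_cancel _ _
  refine ⟨hi2, ?_⟩
  have h2 := integral_eq_lintegral_of_nonneg_ae hnn (hm.const_sub _).aestronglyMeasurable
  rw [← heq, integral_sub (integrable_const _) hi2] at h2
  simp at h2
  linarith

end Laws

lemma lintegral_le_mul_of_le_smul {α : Type*} [MeasurableSpace α] {μ ν : Measure α} {M : ℝ≥0∞}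
    (h : μ ≤ M • ν) (f : α → ℝ≥0∞) : ∫⁻ x, f x ∂μ ≤ M * ∫⁻ x, f x ∂ν := by
  refine (lintegral_mono' h le_rfl).trans ?_
  rw [lintegral_smul_measure, smul_eq_mul]

/-- If one coordinate enters as a factor independent of the others, the law has bounded density. -/
lemma lintegral_pi_comp_le {m : ℕ} {μ : Measure Circle} [IsProbabilityMeasure μ] {M : ℝ≥0∞}
    (hM : μ ≤ M • circleHaar) (l : Fin (m + 1)) {g : (Fin m → Circle) → Circle}
    (hg : Measurable g) {f : Circle → ℝ≥0∞} (hf : Measurable f) :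
    ∫⁻ z : Fin (m + 1) → Circle, f (z l * g fun i => z (l.succAbove i)) ∂(Measure.pi fun _ => μ) ≤
      M * ∫⁻ w, f w ∂circleHaar := by
  have hmp := measurePreserving_piFinSuccAbove (fun _ : Fin (m + 1) => μ) l
  have hF : Measurable fun p : Circle × (Fin m → Circle) => f (p.1 * g p.2) :=
    hf.comp (measurable_fst.mul (hg.comp measurable_snd))
  have h1 := hmp.lintegral_comp hF
  refine (le_of_eq h1).trans ?_
  rw [lintegral_prod_symm' _ hF]
  calc ∫⁻ y, ∫⁻ x, f (x * g y) ∂μ ∂(Measure.pi fun _ => μ)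
      ≤ ∫⁻ _ : Fin m → Circle, M * ∫⁻ w, f w ∂circleHaar ∂(Measure.pi fun _ => μ) := by
        refine lintegral_mono fun y => (lintegral_le_mul_of_le_smul hM _).trans ?_
        rw [lintegral_mul_right_eq_self f]
    _ = _ := by simp

lemma lintegral_pi_pair {m : ℕ} {μ : Measure Circle} [IsProbabilityMeasure μ] {i j : Fin (m + 1)}
    (hij : i ≠ j) {f : Circle × Circle → ℝ≥0∞} (hf : Measurable f) :
    ∫⁻ z : Fin (m + 1) → Circle, f (z i, z j) ∂(Measure.pi fun _ => μ) =
      ∫⁻ p, f p ∂(μ.prod μ) := by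
  obtain ⟨j', rfl⟩ := Fin.exists_succAbove_eq hij.symm
  have hmp := measurePreserving_piFinSuccAbove (fun _ : Fin (m + 1) => μ) i
  have hF : Measurable fun p : Circle × (Fin m → Circle) => f (p.1, p.2 j') :=
    hf.comp (by fun_prop)
  refine (hmp.lintegral_comp hF).trans ?_
  rw [lintegral_prod _ hF.aemeasurable, lintegral_prod _ hf.aemeasurable]
  refine lintegral_congr fun x => ?_
  exact (measurePreserving_eval (fun _ : Fin m => μ) j').lintegral_comp
    (hf.comp measurable_prodMk_left)

lemma pi_le_smul_pi {m : ℕ} {μ ν : Measure Circle} [IsProbabilityMeasure μ] [IsProbabilityMeasure ν]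
    {M : NNReal} (hM : μ ≤ M • ν) :
    (Measure.pi fun _ : Fin m => μ) ≤ (M ^ m) • Measure.pi fun _ : Fin m => ν := by
  have h1 : (Measure.pi fun _ : Fin m => M • ν) = (M ^ m) • Measure.pi fun _ : Fin m => ν := by
    refine Measure.pi_eq fun s hs => ?_
    simp only [Measure.smul_apply, Measure.pi_pi, ENNReal.smul_def, smul_eq_mul,
      Finset.prod_mul_distrib]
    simp
  rw [← h1]
  refine Measure.le_iff.2 fun s hs => ?_
  have h2 : (Measure.pi fun _ : Fin m => μ).toOuterMeasure ≤
      OuterMeasure.pi fun _ : Fin m => (M • ν).toOuterMeasure := by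
    refine OuterMeasure.le_pi.2 fun t _ => ?_
    change (Measure.pi fun _ : Fin m => μ) (Set.univ.pi t) ≤ ∏ i, (M • ν) (t i)
    rw [Measure.pi_pi]
    exact Finset.prod_le_prod' fun i _ => hM _
  have h3 : (Measure.pi fun _ : Fin m => M • ν) s =
      OuterMeasure.pi (fun _ : Fin m => (M • ν).toOuterMeasure) s := by
    rw [Measure.pi, toMeasure_apply _ _ hs]
  rw [h3]
  exact h2 s

section Smoothing

/-- Normalised Haar measure on a small ball around `1`. -/
def ballMeasure (k : ℕ) : Measure Circle :=
  (circleHaar (Metric.ball 1 (1 / ((k : ℝ) + 1))))⁻¹ •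
    circleHaar.restrict (Metric.ball 1 (1 / ((k : ℝ) + 1)))

lemma circleHaar_ball_ne_zero (k : ℕ) : circleHaar (Metric.ball 1 (1 / ((k : ℝ) + 1))) ≠ 0 :=
  (Metric.measure_ball_pos circleHaar 1 (by positivity)).ne'

instance isProbabilityMeasure_ballMeasure (k : ℕ) : IsProbabilityMeasure (ballMeasure k) := by
  constructor
  rw [ballMeasure, Measure.smul_apply, Measure.restrict_apply_univ, smul_eq_mul]
  exact ENNReal.inv_mul_cancel (circleHaar_ball_ne_zero k) (measure_ne_top _ _)

lemma ballMeasure_le (k : ℕ) :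
    ballMeasure k ≤ (circleHaar (Metric.ball 1 (1 / ((k : ℝ) + 1))))⁻¹ • circleHaar := by
  rw [ballMeasure]
  gcongr
  exact Measure.restrict_le_self

lemma ae_ballMeasure_dist_lt (k : ℕ) : ∀ᵐ y ∂(ballMeasure k), dist y 1 < 1 / ((k : ℝ) + 1) :=
  Measure.ae_smul_measure (ae_restrict_mem measurableSet_ball) _

/-- The convolution of a probability measure with a small ball. -/
def smoothing (μ : ProbabilityMeasure Circle) (k : ℕ) : ProbabilityMeasure Circle :=
  ⟨(μ : Measure Circle) ∗ₘ ballMeasure k, inferInstance⟩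

lemma smoothing_le (μ : ProbabilityMeasure Circle) (k : ℕ) : (smoothing μ k : Measure Circle) ≤
    (circleHaar (Metric.ball 1 (1 / ((k : ℝ) + 1))))⁻¹ • circleHaar := by
  set c := (circleHaar (Metric.ball 1 (1 / ((k : ℝ) + 1))))⁻¹
  refine Measure.le_iff.2 fun s hs => ?_
  have hind : Measurable (s.indicator (1 : Circle → ℝ≥0∞)) := measurable_one.indicator hs
  rw [← lintegral_indicator_one hs]
  change ∫⁻ x, s.indicator 1 x ∂((μ : Measure Circle) ∗ₘ ballMeasure k) ≤ _
  rw [Measure.lintegral_mconv hind]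
  calc ∫⁻ x, ∫⁻ y, s.indicator 1 (x * y) ∂ballMeasure k ∂(μ : Measure Circle)
      ≤ ∫⁻ _, c * ∫⁻ y, s.indicator 1 y ∂circleHaar ∂(μ : Measure Circle) := by
        refine lintegral_mono fun x => (lintegral_le_mul_of_le_smul (ballMeasure_le k) _).trans ?_
        rw [lintegral_mul_left_eq_self (s.indicator (1 : Circle → ℝ≥0∞)) x]
    _ = (c • circleHaar) s := by simp [lintegral_indicator_one hs]

lemma logEnergy_smoothing_le (μ : ProbabilityMeasure Circle) (k : ℕ) :
    logEnergy (smoothing μ k : Measure Circle) ≤ logEnergy (μ : Measure Circle) := by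
  refine ENNReal.tsum_le_tsum fun j => ENNReal.ofReal_le_ofReal ?_
  have h : circleMoment (j + 1) (smoothing μ k : Measure Circle) =
      circleMoment (j + 1) (μ : Measure Circle) * circleMoment (j + 1) (ballMeasure k) := by
    change ∫ ζ : Circle, (ζ : ℂ) ^ (j + 1) ∂((μ : Measure Circle) ∗ₘ ballMeasure k) = _
    rw [integral_mconv (integrable_of_continuous (by fun_prop))]
    simp_rw [Circle.coe_mul, mul_pow, integral_const_mul, integral_mul_const]
    rfl
  rw [h, norm_mul]
  gcongr
  exact mul_le_of_le_one_right (norm_nonneg _) (norm_circleMoment_le _ _)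

lemma Circle.dist_mul_self (x y : Circle) : dist (x * y) x = dist y 1 := by
  change dist ((x * y : Circle) : ℂ) (x : ℂ) = dist (y : ℂ) ((1 : Circle) : ℂ)
  rw [dist_eq_norm, dist_eq_norm, Circle.coe_mul, Circle.coe_one,
    show (x : ℂ) * y - x = x * (y - 1) by ring, norm_mul, Circle.norm_coe, one_mul]

lemma tendsto_smoothing (μ : ProbabilityMeasure Circle) :
    Tendsto (smoothing μ) atTop (𝓝 μ) := by
  refine ProbabilityMeasure.tendsto_iff_forall_integral_tendsto.2 fun f => ?_
  have hf : Continuous fun x => f x := f.continuous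
  have huc := CompactSpace.uniformContinuous_of_continuous hf
  rw [Metric.tendsto_atTop]
  intro ε hε
  obtain ⟨δ, hδ, h⟩ := Metric.uniformContinuous_iff.1 huc (ε / 2) (half_pos hε)
  obtain ⟨K, hK⟩ := exists_nat_one_div_lt hδ
  refine ⟨K, fun k hk => ?_⟩
  have hmul : Continuous fun p : Circle × Circle => f (p.1 * p.2) := hf.comp continuous_mul
  have h1 : ∫ x, f x ∂(smoothing μ k : Measure Circle) =
      ∫ x, ∫ y, f (x * y) ∂ballMeasure k ∂(μ : Measure Circle) :=
    integral_mconv (integrable_of_continuous hf)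
  have hin : Integrable (fun x => ∫ y, f (x * y) ∂ballMeasure k) (μ : Measure Circle) :=
    (integrable_of_continuous (μ := (μ : Measure Circle).prod (ballMeasure k)) hmul).integral_prod_left
  rw [dist_eq_norm, h1, ← integral_sub hin (integrable_of_continuous hf)]
  refine lt_of_le_of_lt (norm_integral_le_of_norm_le_const (C := ε / 2)
    (Eventually.of_forall fun x => ?_)) (by simp [hε])
  have h2 : ∫ y, f (x * y) ∂ballMeasure k - f x = ∫ y, (f (x * y) - f x) ∂ballMeasure k := by
    rw [integral_sub (integrable_of_continuous (by fun_prop)) (integrable_const _)]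
    simp
  rw [h2]
  refine (norm_integral_le_of_norm_le_const (C := ε / 2) ?_).trans (by simp)
  filter_upwards [ae_ballMeasure_dist_lt k] with y hy
  rw [← dist_eq_norm]
  refine (h ?_).le
  rw [Circle.dist_mul_self]
  refine hy.trans (lt_of_le_of_lt ?_ hK)
  exact one_div_le_one_div_of_le (by positivity) (by exact_mod_cast Nat.succ_le_succ hk)

lemma exists_le_smul_circleHaar_mem_nhds (μ : ProbabilityMeasure Circle)
    {U : Set (ProbabilityMeasure Circle)} (hU : U ∈ 𝓝 μ) :
    ∃ ν ∈ U, (∃ M : NNReal, (ν : Measure Circle) ≤ M • circleHaar) ∧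
      logEnergy (ν : Measure Circle) ≤ logEnergy (μ : Measure Circle) := by
  obtain ⟨k, hk⟩ := ((tendsto_smoothing μ).eventually hU).exists
  refine ⟨_, hk, ⟨((circleHaar (Metric.ball 1 (1 / ((k : ℝ) + 1))))⁻¹).toNNReal, ?_⟩,
    logEnergy_smoothing_le μ k⟩
  have := smoothing_le μ k
  rwa [← ENNReal.coe_toNNReal (ENNReal.inv_ne_top.2 (circleHaar_ball_ne_zero k))] at this

end Smoothing

lemma suTuple_castSucc {m : ℕ} (z : Fin m → Circle) (i : Fin m) : suTuple z i.castSucc = z i := by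
  simp [suTuple]

lemma suTuple_last {m : ℕ} (z : Fin m → Circle) : suTuple z (Fin.last m) = (∏ i, z i)⁻¹ := by
  simp [suTuple]

/-- The logarithm of the weight, wherever the weight does not vanish. -/
def suLogWeight (Q : Circle → ℝ) (m : ℕ) (z : Fin m → Circle) : ℝ :=
  -((m : ℝ) + 1) * ∑ i, Q (suTuple z i) +
    ∑ i, ∑ j ∈ Finset.Ioi i, 2 * Real.log ‖(1 - (suTuple z i / suTuple z j : Circle) : ℂ)‖

lemma exp_suLogWeight {Q : Circle → ℝ} {m : ℕ} {z : Fin m → Circle}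
    (h : ∀ i j, i < j → suTuple z i / suTuple z j ≠ 1) :
    Real.exp (suLogWeight Q m z) = suWeight Q m z := by
  rw [suLogWeight, suWeight, Real.exp_add]
  simp_rw [Real.exp_sum]
  congr 1
  refine Finset.prod_congr rfl fun i _ => Finset.prod_congr rfl fun j hj => ?_
  have hne : suTuple z i / suTuple z j ≠ 1 := h i j (Finset.mem_Ioi.1 hj)
  rw [← norm_one_sub_div, two_mul, Real.exp_add, ← sq, Real.exp_log]
  refine norm_pos_iff.2 fun h0 => hne (Circle.ext ?_)
  simpa using (sub_eq_zero.1 h0).symm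

lemma sum_sum_Ioi_two_mul_const {n : ℕ} (c : ℝ) :
    ∑ i : Fin n, ∑ _j ∈ Finset.Ioi i, 2 * c = (n : ℝ) ^ 2 * c - n * c := by
  rw [sum_sum_Ioi_two_mul (b := fun _ _ => c) fun _ _ => rfl]
  simp
  ring

lemma suLogWeight_le {Q : Circle → ℝ} {K : ℝ} (hK : ∀ ζ, |Q ζ| ≤ K) (m : ℕ) (z : Fin m → Circle) :
    suLogWeight Q m z ≤ ((m : ℝ) + 1) ^ 2 * (K + Real.log 2) := by
  have hlog2 : 0 ≤ Real.log 2 := Real.log_nonneg (by norm_num)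
  have h1 : ∑ i, ∑ j ∈ Finset.Ioi i,
      2 * Real.log ‖(1 - (suTuple z i / suTuple z j : Circle) : ℂ)‖ ≤
      ∑ i : Fin (m + 1), ∑ _j ∈ Finset.Ioi i, 2 * Real.log 2 :=
    Finset.sum_le_sum fun i _ => Finset.sum_le_sum fun j _ => by
      have := log_norm_one_sub_le (suTuple z i / suTuple z j)
      linarith
  rw [sum_sum_Ioi_two_mul_const] at h1
  have h2 : -(((m : ℝ) + 1) * K) ≤ ∑ i, Q (suTuple z i) := by
    have h3 : ∑ _i : Fin (m + 1), -K ≤ ∑ i, Q (suTuple z i) :=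
      Finset.sum_le_sum fun i _ => (abs_le.1 (hK _)).1
    simpa using h3
  have h4 := mul_le_mul_of_nonneg_left h2 (by positivity : 0 ≤ (m : ℝ) + 1)
  have h5 : 0 ≤ ((m : ℝ) + 1) * Real.log 2 := by positivity
  rw [suLogWeight]
  rw [Nat.cast_add, Nat.cast_one] at h1
  nlinarith

section PairExpectation

variable {k : ℕ} {μ : Measure Circle} [IsProbabilityMeasure μ] {M : NNReal}

lemma lintegral_circleKernel_suTuple_castSucc {i j : Fin (k + 2)} (hij : i ≠ j) :
    ∫⁻ z : Fin (k + 2) → Circle,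
      circleKernel (suTuple z i.castSucc / suTuple z j.castSucc) ∂(Measure.pi fun _ => μ) =
      ENNReal.ofReal (Real.log 2) + logEnergy μ := by
  simp_rw [suTuple_castSucc, ← logKernel_one_eq]
  rw [lintegral_pi_pair hij (continuous_logKernel 1).measurable, lintegral_logKernel_one]

lemma lintegral_circleKernel_suTuple_last (hM : μ ≤ M • circleHaar) (i : Fin (k + 2)) :
    ∫⁻ z : Fin (k + 2) → Circle,
      circleKernel (suTuple z i.castSucc / suTuple z (Fin.last _)) ∂(Measure.pi fun _ => μ) ≤
      M * ENNReal.ofReal (Real.log 2) := by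
  obtain ⟨l, hl⟩ := exists_ne i
  obtain ⟨i', rfl⟩ := Fin.exists_succAbove_eq hl.symm
  have hg : Measurable fun y : Fin (k + 1) → Circle => y i' * ∏ j, y j :=
    (by fun_prop : Continuous fun y : Fin (k + 1) → Circle => y i' * ∏ j, y j).measurable
  have h := lintegral_pi_comp_le (M := (M : ℝ≥0∞)) hM l hg measurable_circleKernel
  rw [lintegral_circleKernel_circleHaar] at h
  refine le_trans (le_of_eq (lintegral_congr fun z => ?_)) h
  rw [suTuple_castSucc, suTuple_last, Fin.prod_univ_succAbove _ l]
  congr 1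
  rw [div_inv_eq_mul]
  exact mul_left_comm _ _ _

lemma suTuple_pair_expectation (hM : μ ≤ M • circleHaar) (hfin : logEnergy μ ≠ ⊤)
    {i j : Fin (k + 2 + 1)} (hij : i < j) :
    (∀ᵐ z ∂(Measure.pi fun _ : Fin (k + 2) => μ), suTuple z i / suTuple z j ≠ 1) ∧
    Integrable (fun z => Real.log ‖(1 - (suTuple z i / suTuple z j : Circle) : ℂ)‖)
      (Measure.pi fun _ : Fin (k + 2) => μ) ∧
    -((logEnergy μ).toReal + if j = Fin.last _ then M * Real.log 2 else 0) ≤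
      ∫ z, Real.log ‖(1 - (suTuple z i / suTuple z j : Circle) : ℂ)‖
        ∂(Measure.pi fun _ : Fin (k + 2) => μ) := by
  have hlog2 : 0 ≤ Real.log 2 := Real.log_nonneg (by norm_num)
  have hX : Measurable fun z : Fin (k + 2) → Circle => suTuple z i / suTuple z j :=
    (((continuous_apply i).comp (continuous_suTuple _)).div'
      ((continuous_apply j).comp (continuous_suTuple _))).measurable
  have hi : i ≠ Fin.last _ := (lt_of_lt_of_le hij (Fin.le_last j)).ne
  obtain ⟨i, rfl⟩ := Fin.exists_castSucc_eq.2 hi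
  by_cases hj : j = Fin.last _
  · subst hj
    have h := lintegral_circleKernel_suTuple_last hM i
    have hne : (M : ℝ≥0∞) * ENNReal.ofReal (Real.log 2) ≠ ⊤ :=
      ENNReal.mul_ne_top ENNReal.coe_ne_top ENNReal.ofReal_ne_top
    have hf := ne_top_of_le_ne_top hne h
    refine ⟨ae_ne_one_of_lintegral_circleKernel hX hf,
      (integrable_log_of_lintegral_circleKernel hX hf).1, ?_⟩
    rw [(integrable_log_of_lintegral_circleKernel hX hf).2]
    have h2 := ENNReal.toReal_mono hne h
    rw [ENNReal.toReal_mul, ENNReal.toReal_ofReal hlog2, ENNReal.coe_toReal] at h2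
    have h3 : 0 ≤ (logEnergy μ).toReal := ENNReal.toReal_nonneg
    simp only [if_true]
    linarith
  · obtain ⟨j, rfl⟩ := Fin.exists_castSucc_eq.2 hj
    have h := lintegral_circleKernel_suTuple_castSucc (μ := μ)
      (fun h => hij.ne (congrArg Fin.castSucc h) : i ≠ j)
    have hf : ∫⁻ z : Fin (k + 2) → Circle,
      circleKernel (suTuple z i.castSucc / suTuple z j.castSucc) ∂(Measure.pi fun _ => μ) ≠ ⊤ := by
      rw [h]
      exact ENNReal.add_ne_top.2 ⟨ENNReal.ofReal_ne_top, hfin⟩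
    refine ⟨ae_ne_one_of_lintegral_circleKernel hX hf,
      (integrable_log_of_lintegral_circleKernel hX hf).1, ?_⟩
    rw [(integrable_log_of_lintegral_circleKernel hX hf).2, h, if_neg hj,
      ENNReal.toReal_add ENNReal.ofReal_ne_top hfin, ENNReal.toReal_ofReal hlog2]
    linarith

lemma integrable_suLogWeight {Q : Circle → ℝ} (hQ : Continuous Q) (hM : μ ≤ M • circleHaar)
    (hfin : logEnergy μ ≠ ⊤) :
    Integrable (suLogWeight Q (k + 2)) (Measure.pi fun _ : Fin (k + 2) => μ) := by
  refine Integrable.add (Integrable.const_mul ?_ _) ?_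
  · exact integrable_finsetSum _ fun i _ => integrable_of_continuous
      (hQ.comp ((continuous_apply i).comp (continuous_suTuple _)))
  · exact integrable_finsetSum _ fun i _ => integrable_finsetSum _ fun j hj =>
      (suTuple_pair_expectation hM hfin (Finset.mem_Ioi.1 hj)).2.1.const_mul 2

lemma ae_exp_suLogWeight {Q : Circle → ℝ} (hM : μ ≤ M • circleHaar) (hfin : logEnergy μ ≠ ⊤) :
    ∀ᵐ z ∂(Measure.pi fun _ : Fin (k + 2) => μ),
      Real.exp (suLogWeight Q (k + 2) z) = suWeight Q (k + 2) z := by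
  have h : ∀ᵐ z ∂(Measure.pi fun _ : Fin (k + 2) => μ), ∀ i j : Fin (k + 2 + 1), i < j →
      suTuple z i / suTuple z j ≠ 1 := by
    refine ae_all_iff.2 fun i => ae_all_iff.2 fun j => ?_
    by_cases hij : i < j
    · filter_upwards [(suTuple_pair_expectation hM hfin hij).1] with z hz _ using hz
    · exact Eventually.of_forall fun _ h => absurd h hij
  filter_upwards [h] with z hz using exp_suLogWeight hz

lemma integral_suLogWeight_ge {Q : Circle → ℝ} (hQ : Continuous Q) {K : ℝ}
    (hK : ∀ ζ, |Q ζ| ≤ K) (hM : μ ≤ M • circleHaar) (hfin : logEnergy μ ≠ ⊤) :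
    -((((k + 2 : ℕ) : ℝ) + 1) ^ 2 * ((logEnergy μ).toReal + ∫ ζ, Q ζ ∂μ)) -
        (((k + 2 : ℕ) : ℝ) + 1) * (2 * K + 2 * (M * Real.log 2)) ≤
      ∫ z, suLogWeight Q (k + 2) z ∂(Measure.pi fun _ : Fin (k + 2) => μ) := by
  set P := Measure.pi fun _ : Fin (k + 2) => μ
  have hlog2 : 0 ≤ Real.log 2 := Real.log_nonneg (by norm_num)
  set C : ℝ := M * Real.log 2
  have hC : 0 ≤ C := by positivity
  set E := (logEnergy μ).toReal
  have hE : 0 ≤ E := ENNReal.toReal_nonneg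
  have hQi : ∀ i, Integrable (fun z : Fin (k + 2) → Circle => Q (suTuple z i)) P := fun i =>
    integrable_of_continuous (hQ.comp ((continuous_apply i).comp (continuous_suTuple _)))
  have hpi := fun (i j : Fin (k + 2 + 1)) (hij : j ∈ Finset.Ioi i) =>
    suTuple_pair_expectation (μ := μ) (k := k) hM hfin (Finset.mem_Ioi.1 hij)
  have hint : ∫ z, suLogWeight Q (k + 2) z ∂P =
      -(((k + 2 : ℕ) : ℝ) + 1) * ∑ i, ∫ z, Q (suTuple z i) ∂P +
      ∑ i, ∑ j ∈ Finset.Ioi i,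
        2 * ∫ z, Real.log ‖(1 - (suTuple z i / suTuple z j : Circle) : ℂ)‖ ∂P := by
    simp only [suLogWeight]
    rw [integral_add, integral_const_mul, integral_finsetSum _ fun i _ => hQi i,
      integral_finsetSum]
    · congr 1
      refine Finset.sum_congr rfl fun i _ => ?_
      rw [integral_finsetSum _ fun j hj => ((hpi i j hj).2.1.const_mul 2)]
      simp_rw [integral_const_mul]
      rfl
    · exact fun i _ => integrable_finsetSum _ fun j hj => (hpi i j hj).2.1.const_mul 2
    · exact (integrable_finsetSum _ fun i _ => hQi i).const_mul _
    · exact integrable_finsetSum _ fun i _ => integrable_finsetSum _ fun j hj =>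
        (hpi i j hj).2.1.const_mul 2
  have hKint : ∀ (ρ : Measure Circle) [IsProbabilityMeasure ρ], |∫ ζ, Q ζ ∂ρ| ≤ K := by
    intro ρ _
    have := norm_integral_le_of_norm_le_const (μ := ρ) (f := Q) (Eventually.of_forall hK)
    simpa using this
  have hq : ∑ i, ∫ z, Q (suTuple z i) ∂P ≤ ((k + 2 : ℕ) : ℝ) * ∫ ζ, Q ζ ∂μ + K := by
    rw [Fin.sum_univ_castSucc]
    have h1 : ∀ i : Fin (k + 2), ∫ z, Q (suTuple z i.castSucc) ∂P = ∫ ζ, Q ζ ∂μ := by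
      intro i
      simp_rw [suTuple_castSucc]
      exact integral_comp_eval (μ := fun _ : Fin (k + 2) => μ) hQ.aestronglyMeasurable
    have h2 : ∫ z, Q (suTuple z (Fin.last _)) ∂P ≤ K := by
      refine (integral_mono (hQi _) (integrable_const K) fun z => (abs_le.1 (hK _)).2).trans ?_
      simp [P]
    simp_rw [h1]
    simp only [Finset.sum_const, Finset.card_univ, Fintype.card_fin, nsmul_eq_mul]
    linarith
  have hl : ∑ i : Fin (k + 2 + 1), ∑ j ∈ Finset.Ioi i,
        2 * (-(E + if j = Fin.last _ then C else 0)) ≤ ∑ i, ∑ j ∈ Finset.Ioi i,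
        2 * ∫ z, Real.log ‖(1 - (suTuple z i / suTuple z j : Circle) : ℂ)‖ ∂P :=
    Finset.sum_le_sum fun i _ => Finset.sum_le_sum fun j hj =>
      mul_le_mul_of_nonneg_left (hpi i j hj).2.2 zero_le_two
  have hl2 : -((((k + 2 : ℕ) : ℝ) + 1) ^ 2 * E) - (((k + 2 : ℕ) : ℝ) + 1) * (2 * C) ≤
      ∑ i : Fin (k + 2 + 1), ∑ j ∈ Finset.Ioi i,
        2 * (-(E + if j = Fin.last _ then C else 0)) := by
    have h1 : ∀ i : Fin (k + 2 + 1), ∑ j ∈ Finset.Ioi i, (if j = Fin.last _ then C else 0) ≤ C := by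
      intro i
      rw [Finset.sum_ite_eq']
      split_ifs <;> simp [hC]
    have h2 : ∑ i : Fin (k + 2 + 1), ∑ j ∈ Finset.Ioi i,
        2 * (-(E + if j = Fin.last _ then C else 0)) =
        -(∑ i : Fin (k + 2 + 1), ∑ _j ∈ Finset.Ioi i, 2 * E) -
          2 * ∑ i : Fin (k + 2 + 1), ∑ j ∈ Finset.Ioi i, (if j = Fin.last _ then C else 0) := by
      simp_rw [mul_neg, mul_add, Finset.sum_neg_distrib, Finset.sum_add_distrib, ← Finset.mul_sum]
      ring
    have h3 : ∑ i : Fin (k + 2 + 1), ∑ j ∈ Finset.Ioi i, (if j = Fin.last _ then C else 0) ≤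
        ((k + 2 : ℕ) + 1 : ℝ) * C := by
      refine (Finset.sum_le_sum fun i _ => h1 i).trans ?_
      simp
    rw [h2, sum_sum_Ioi_two_mul_const]
    have h4 : 0 ≤ (((k + 2 : ℕ) : ℝ) + 1) * E := by positivity
    push_cast at h3 h4 ⊢
    nlinarith
  rw [hint]
  have hqq := mul_le_mul_of_nonneg_left hq (by positivity : 0 ≤ ((k + 2 : ℕ) : ℝ) + 1)
  have hqK := (abs_le.1 (hKint μ)).1
  have hqK2 : -((((k + 2 : ℕ) : ℝ) + 1) * K) ≤ (((k + 2 : ℕ) : ℝ) + 1) * ∫ ζ, Q ζ ∂μ := by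
    have := mul_le_mul_of_nonneg_left hqK (by positivity : 0 ≤ ((k + 2 : ℕ) : ℝ) + 1)
    linarith
  nlinarith

end PairExpectation

/-- A form of Jensen's inequality for the exponential on a set of nearly full measure. -/
lemma lintegral_exp_ge {Ω : Type*} [MeasurableSpace Ω] {P : Measure Ω} [IsProbabilityMeasure P]
    {A : Set Ω} (hA : MeasurableSet A) {f : Ω → ℝ} (hf : Integrable f P) {K : ℝ}
    (hK : ∀ ω, f ω ≤ K) (hp : 0 < P.real A) :
    ENNReal.ofReal (P.real A * Real.exp ((∫ ω, f ω ∂P - K * (1 - P.real A)) / P.real A)) ≤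
      ∫⁻ ω in A, ENNReal.ofReal (Real.exp (f ω)) ∂P := by
  set p := P.real A
  set a := (∫ ω, f ω ∂P - K * (1 - p)) / p
  have h1 : ∫ ω, f ω ∂P ≤ ∫ ω in A, f ω ∂P + K * (1 - p) := by
    rw [← integral_add_compl hA hf]
    have h2 : ∫ ω in Aᶜ, f ω ∂P ≤ ∫ _ in Aᶜ, K ∂P :=
      integral_mono hf.integrableOn (integrable_const _) hK
    rw [setIntegral_const, smul_eq_mul, probReal_compl_eq_one_sub hA] at h2
    linarith
  have ha : a * p ≤ ∫ ω in A, f ω ∂P := by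
    simp only [a]
    rw [div_mul_cancel₀ _ hp.ne']
    linarith
  have hexp : Integrable (fun ω => Real.exp (f ω)) (P.restrict A) := by
    refine Integrable.mono' (integrable_const (Real.exp K))
      (Real.continuous_exp.comp_aestronglyMeasurable hf.aestronglyMeasurable).restrict
      (Eventually.of_forall fun ω => ?_)
    rw [Real.norm_of_nonneg (Real.exp_pos _).le]
    exact Real.exp_le_exp.2 (hK ω)
  rw [← ofReal_integral_eq_lintegral_ofReal hexp (Eventually.of_forall fun ω => (Real.exp_pos _).le)]
  refine ENNReal.ofReal_le_ofReal ?_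
  have hlin : Integrable (fun ω => Real.exp a * (1 - a + f ω)) (P.restrict A) :=
    ((integrable_const _).add hf.integrableOn).const_mul _
  calc p * Real.exp a ≤ Real.exp a * ((1 - a) * p + ∫ ω in A, f ω ∂P) := by
        nlinarith [Real.exp_pos a]
    _ = ∫ ω in A, Real.exp a * (1 - a + f ω) ∂P := by
        rw [integral_const_mul, integral_add (integrable_const _) hf.integrableOn,
          setIntegral_const, smul_eq_mul, mul_comm p]
    _ ≤ ∫ ω in A, Real.exp (f ω) ∂P := by
        refine integral_mono hlin hexp fun ω => ?_
        have h3 : Real.exp (f ω) = Real.exp a * Real.exp (f ω - a) := by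
          rw [← Real.exp_add]; congr 1; ring
        simp only
        rw [h3]
        refine mul_le_mul_of_nonneg_left ?_ (Real.exp_pos a).le
        linarith [Real.add_one_le_exp (f ω - a)]

/-- The sets which contain the empirical measure with probability tending to one, when the free
coordinates are independent with law `μ`. -/
def empiricalFilter (μ : ProbabilityMeasure Circle) : Filter (ProbabilityMeasure Circle) where
  sets := {U | Tendsto (fun m : ℕ => (Measure.pi fun _ : Fin m => (μ : Measure Circle))
    {z | empiricalMeasure (suTuple z) ∉ U}) atTop (𝓝 0)}
  univ_sets := by simp
  sets_of_superset := by
    intro U V hU hUV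
    exact tendsto_of_tendsto_of_tendsto_of_le_of_le tendsto_const_nhds hU (fun _ => zero_le)
      fun m => measure_mono fun z hz hzU => hz (hUV hzU)
  inter_sets := by
    intro U V hU hV
    have h := Tendsto.add hU hV
    rw [add_zero] at h
    refine tendsto_of_tendsto_of_tendsto_of_le_of_le tendsto_const_nhds h (fun _ => zero_le)
      fun m => (measure_mono fun z hz => ?_).trans (measure_union_le _ _)
    by_contra hcon
    simp only [Set.mem_union, Set.mem_ofPred_eq, not_or, not_not] at hcon
    exact hz hcon

lemma mem_empiricalFilter {μ : ProbabilityMeasure Circle} {U : Set (ProbabilityMeasure Circle)} :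
    U ∈ empiricalFilter μ ↔
      Tendsto (fun m : ℕ => (Measure.pi fun _ : Fin m => (μ : Measure Circle))
        {z | empiricalMeasure (suTuple z) ∉ U}) atTop (𝓝 0) := Iff.rfl

lemma measure_deviation_le (μ : Measure Circle) [IsProbabilityMeasure μ] {f : Circle → ℝ}
    (hf : Continuous f) {c : ℝ} (hc : 0 < c) (m : ℕ) :
    (Measure.pi fun _ : Fin m => μ) {z | c ≤ |∑ i, f (z i) - m * ∫ ζ, f ζ ∂μ|} ≤
      ENNReal.ofReal (m * Var[f; μ] / c ^ 2) := by
  have hL : MemLp f 2 μ := by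
    obtain ⟨C, hC⟩ := isCompact_univ.exists_bound_of_continuousOn hf.continuousOn
    exact MemLp.of_bound hf.aestronglyMeasurable C (Eventually.of_forall fun x => hC x trivial)
  have hmem : MemLp (∑ i : Fin m, fun z : Fin m → Circle => f (z i)) 2
      (Measure.pi fun _ : Fin m => μ) :=
    memLp_finsetSum' _ fun i _ => hL.comp_measurePreserving (measurePreserving_eval _ i)
  have h := meas_ge_le_variance_div_sq hmem hc
  rw [variance_sum_pi (X := fun _ : Fin m => f) (fun _ => hL)] at h
  have hE : ∫ z, (∑ i : Fin m, fun z : Fin m → Circle => f (z i)) z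
      ∂(Measure.pi fun _ : Fin m => μ) = m * ∫ ζ, f ζ ∂μ := by
    simp_rw [Finset.sum_apply]
    rw [integral_finsetSum _ fun i _ => integrable_of_continuous (by fun_prop)]
    have h1 : ∀ i : Fin m, ∫ z : Fin m → Circle, f (z i) ∂(Measure.pi fun _ => μ) = ∫ ζ, f ζ ∂μ :=
      fun i => integral_comp_eval (μ := fun _ : Fin m => μ) hf.aestronglyMeasurable
    simp_rw [h1]
    simp
  rw [hE] at h
  simpa using h

lemma empiricalFilter_le_nhds (μ : ProbabilityMeasure Circle) : empiricalFilter μ ≤ 𝓝 μ := by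
  change Tendsto id (empiricalFilter μ) (𝓝 μ)
  refine ProbabilityMeasure.tendsto_iff_forall_integral_tendsto.2 fun f => ?_
  have hf : Continuous fun x => f x := f.continuous
  set K := ‖f‖
  have hK : ∀ x, |f x| ≤ K := fun x => f.norm_coe_le_norm x
  set c := ∫ ζ, f ζ ∂(μ : Measure Circle)
  have hc : |c| ≤ K := by
    have := norm_integral_le_of_norm_le_const (μ := (μ : Measure Circle)) (f := fun x => f x)
      (Eventually.of_forall hK)
    simpa using this
  set V := Var[fun x => f x; (μ : Measure Circle)]
  have hV : 0 ≤ V := variance_nonneg _ _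
  refine Metric.tendsto_nhds.2 fun ε hε => mem_empiricalFilter.2 ?_
  have hlim : Tendsto (fun m : ℕ => ENNReal.ofReal (4 * V / ε ^ 2 * (1 / ((m : ℝ) + 1)))) atTop
      (𝓝 0) := by
    have := ENNReal.tendsto_ofReal
      ((tendsto_one_div_add_atTop_nhds_zero_nat (𝕜 := ℝ)).const_mul (4 * V / ε ^ 2))
    simpa using this
  refine tendsto_of_tendsto_of_tendsto_of_le_of_le' tendsto_const_nhds hlim
    (Eventually.of_forall fun _ => zero_le) ?_
  obtain ⟨N, hN⟩ := exists_nat_ge (4 * K / ε)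
  filter_upwards [eventually_ge_atTop N] with m hm
  have hn : (0 : ℝ) < (m : ℝ) + 1 := by positivity
  have hmN : 4 * K ≤ ((m : ℝ) + 1) * ε := by
    rw [div_le_iff₀ hε] at hN
    have : (N : ℝ) ≤ m := by exact_mod_cast hm
    nlinarith
  have hpos : 0 < ((m : ℝ) + 1) * ε / 2 := by positivity
  have h := measure_deviation_le (μ : Measure Circle) hf hpos m
  refine (measure_mono fun z hz => ?_).trans (h.trans (ENNReal.ofReal_le_ofReal ?_))
  · simp only [id, Set.mem_ofPred_eq, not_lt] at hz ⊢
    rw [Real.dist_eq, integral_empiricalMeasure, Fin.sum_univ_castSucc] at hz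
    simp_rw [suTuple_castSucc] at hz
    set S := ∑ i : Fin m, f (z i)
    set y := f (suTuple z (Fin.last m))
    have hy : |y| ≤ K := hK _
    have h1 : ((m : ℝ) + 1)⁻¹ * (S + y) - c = ((m : ℝ) + 1)⁻¹ * ((S - m * c) + (y - c)) := by
      field_simp
      ring
    rw [h1, abs_mul, abs_of_pos (inv_pos.2 hn), le_inv_mul_iff₀ hn] at hz
    have h2 := abs_add_le (S - m * c) (y - c)
    have h3 := abs_sub y c
    linarith
  · rw [div_le_iff₀ (by positivity)]
    have : 4 * V / ε ^ 2 * (1 / ((m : ℝ) + 1)) * ((((m : ℝ) + 1) * ε / 2) ^ 2) =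
        ((m : ℝ) + 1) * V := by
      field_simp
      ring
    rw [this]
    nlinarith

lemma tendsto_measureReal_empiricalMeasure_mem {μ : ProbabilityMeasure Circle}
    {G : Set (ProbabilityMeasure Circle)} (hG : IsOpen G) (hμ : μ ∈ G) :
    Tendsto (fun m : ℕ => (Measure.pi fun _ : Fin m => (μ : Measure Circle)).real
      ((fun z => empiricalMeasure (suTuple z)) ⁻¹' G)) atTop (𝓝 1) := by
  have h := mem_empiricalFilter.1 (empiricalFilter_le_nhds μ (hG.mem_nhds hμ))
  have h2 := (ENNReal.tendsto_toReal ENNReal.zero_ne_top).comp h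
  have h3 := h2.const_sub 1
  simp only [ENNReal.toReal_zero, sub_zero] at h3
  refine h3.congr fun m => ?_
  have hmeas : MeasurableSet ((fun z : Fin m → Circle => empiricalMeasure (suTuple z)) ⁻¹' G) :=
    (hG.preimage (continuous_empiricalMeasure_suTuple m)).measurableSet
  have h4 := probReal_compl_eq_one_sub (μ := Measure.pi fun _ : Fin m => (μ : Measure Circle)) hmeas
  have h5 : (Measure.pi fun _ : Fin m => (μ : Measure Circle)).real
    ((fun z : Fin m → Circle => empiricalMeasure (suTuple z)) ⁻¹' G)ᶜ =
      ((Measure.pi fun _ : Fin m => (μ : Measure Circle))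
        {z | empiricalMeasure (suTuple z) ∉ G}).toReal := rfl
  rw [Function.comp_apply, ← h5, h4]
  ring

lemma suMass_ge {Q : Circle → ℝ} (hQ : Continuous Q) {K : ℝ} (hK : ∀ ζ, |Q ζ| ≤ K)
    {ν : ProbabilityMeasure Circle} {M : NNReal} (hM1 : 1 ≤ M)
    (hM : (ν : Measure Circle) ≤ M • circleHaar) (hfin : logEnergy (ν : Measure Circle) ≠ ⊤)
    {G : Set (ProbabilityMeasure Circle)} (hG : IsOpen G) {m : ℕ} (hm : 2 ≤ m) {p : ℝ}
    (hp : p = (Measure.pi fun _ : Fin m => (ν : Measure Circle)).real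
      ((fun z => empiricalMeasure (suTuple z)) ⁻¹' G)) (hp0 : 0 < p) :
    ENNReal.ofReal (Real.exp (Real.log p +
      (-(((m : ℝ) + 1) ^ 2 * ((logEnergy (ν : Measure Circle)).toReal +
          ∫ ζ, Q ζ ∂(ν : Measure Circle))) -
        ((m : ℝ) + 1) * (2 * K + 2 * (M * Real.log 2)) -
        ((m : ℝ) + 1) ^ 2 * (K + Real.log 2) * (1 - p)) / p -
      ((m : ℝ) + 1) * Real.log M)) ≤ suMass Q m G := by
  obtain ⟨k, rfl⟩ := Nat.exists_eq_add_of_le' hm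
  set P := Measure.pi fun _ : Fin (k + 2) => (ν : Measure Circle)
  set A := (fun z : Fin (k + 2) → Circle => empiricalMeasure (suTuple z)) ⁻¹' G
  have hA : MeasurableSet A :=
    (hG.preimage (continuous_empiricalMeasure_suTuple _)).measurableSet
  have h1 := lintegral_exp_ge hA (integrable_suLogWeight (k := k) hQ hM hfin)
    (suLogWeight_le hK (k + 2)) (hp ▸ hp0)
  rw [← hp] at h1
  have h2 : ∫⁻ z in A, ENNReal.ofReal (Real.exp (suLogWeight Q (k + 2) z)) ∂P =
      ∫⁻ z in A, ENNReal.ofReal (suWeight Q (k + 2) z) ∂P := by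
    refine lintegral_congr_ae (ae_restrict_of_ae ?_)
    filter_upwards [ae_exp_suLogWeight (Q := Q) hM hfin] with z hz
    rw [hz]
  have h3 : ∫⁻ z in A, ENNReal.ofReal (suWeight Q (k + 2) z) ∂P ≤
      (M : ℝ≥0∞) ^ (k + 2) * suMass Q (k + 2) G := by
    have h4 : P.restrict A ≤ ((M : ℝ≥0∞) ^ (k + 2)) •
        (Measure.pi fun _ : Fin (k + 2) => circleHaar).restrict A := by
      rw [← Measure.restrict_smul]
      refine Measure.restrict_mono le_rfl ?_
      have := pi_le_smul_pi (m := k + 2) hM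
      rwa [ENNReal.smul_def, ENNReal.coe_pow] at this
    exact lintegral_le_mul_of_le_smul h4 _
  have hMpos : (0 : ℝ) < M := lt_of_lt_of_le one_pos (by exact_mod_cast hM1)
  have hlogM : 0 ≤ Real.log M := Real.log_nonneg (by exact_mod_cast hM1)
  have h5 : (M : ℝ≥0∞) ^ (k + 2) = ENNReal.ofReal (Real.exp (((k + 2 : ℕ) : ℝ) * Real.log M)) := by
    rw [Real.exp_nat_mul, Real.exp_log hMpos, ENNReal.ofReal_pow hMpos.le, ENNReal.ofReal_coe_nnreal]
  have h6 := h1.trans ((le_of_eq h2).trans h3)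
  rw [h5] at h6
  have h7 := mul_le_mul_right h6 (ENNReal.ofReal (Real.exp (-(((k + 2 : ℕ) : ℝ) * Real.log M))))
  rw [← mul_assoc (ENNReal.ofReal _), ← ENNReal.ofReal_mul (Real.exp_pos _).le,
    ← ENNReal.ofReal_mul (Real.exp_pos _).le, ← Real.exp_add, neg_add_cancel, Real.exp_zero,
    ENNReal.ofReal_one, one_mul] at h7
  refine le_trans (ENNReal.ofReal_le_ofReal ?_) h7
  have hprod : ∀ a b : ℝ, Real.exp a * (p * Real.exp b) = Real.exp (a + (Real.log p + b)) := by
    intro a b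
    rw [Real.exp_add, Real.exp_add, Real.exp_log hp0]
  rw [hprod]
  refine Real.exp_le_exp.2 ?_
  have h8 := integral_suLogWeight_ge (k := k) hQ hK hM hfin
  have h9 := div_le_div_of_nonneg_right (sub_le_sub_right h8
    ((((k + 2 : ℕ) : ℝ) + 1) ^ 2 * (K + Real.log 2) * (1 - p))) hp0.le
  linarith

lemma neg_le_liminf_log_suMass {Q : Circle → ℝ} (hQ : Continuous Q)
    {ν : ProbabilityMeasure Circle} {M : NNReal}
    (hM : (ν : Measure Circle) ≤ M • circleHaar) (hfin : logEnergy (ν : Measure Circle) ≠ ⊤)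
    {G : Set (ProbabilityMeasure Circle)} (hG : IsOpen G) (hν : ν ∈ G) :
    -weightedEnergy Q ν ≤ liminf (fun m : ℕ => (((1 : ℝ) / ((m : ℝ) + 1) ^ 2 : ℝ) : EReal) *
      ENNReal.log (suMass Q m G)) atTop := by
  obtain ⟨K, hK⟩ := isCompact_univ.exists_bound_of_continuousOn hQ.continuousOn
  replace hK : ∀ ζ, |Q ζ| ≤ K := fun ζ => hK ζ trivial
  wlog hM1 : 1 ≤ M generalizing M
  · refine this (M := max M 1) (hM.trans ?_) (le_max_right _ _)
    refine Measure.le_iff.2 fun s _ => ?_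
    simp only [Measure.smul_apply]
    gcongr
    exact le_max_left _ _
  set I := (logEnergy (ν : Measure Circle)).toReal + ∫ ζ, Q ζ ∂(ν : Measure Circle) with hI
  have hwE : weightedEnergy Q ν = (I : EReal) := by
    rw [weightedEnergy, hI, EReal.coe_add, EReal.coe_ennreal_toReal hfin]
  set C := 2 * K + 2 * (M * Real.log 2)
  have hpl := tendsto_measureReal_empiricalMeasure_mem hG hν
  set p : ℕ → ℝ := fun m => (Measure.pi fun _ : Fin m => (ν : Measure Circle)).real
      ((fun z => empiricalMeasure (suTuple z)) ⁻¹' G) with hpdef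
  have hn := tendsto_one_div_add_atTop_nhds_zero_nat (𝕜 := ℝ)
  have hlim : Tendsto (fun m : ℕ => (1 / ((m : ℝ) + 1)) ^ 2 * Real.log (p m) +
      (-I - (1 / ((m : ℝ) + 1)) * C - (K + Real.log 2) * (1 - p m)) / p m -
        (1 / ((m : ℝ) + 1)) * Real.log M) atTop (𝓝 (-I)) := by
    have h1 := ((hn.pow 2).mul (hpl.log one_ne_zero)).add
      (((tendsto_const_nhds (x := -I)).sub (hn.mul_const C)).sub
        ((hpl.const_sub 1).const_mul (K + Real.log 2)) |>.div hpl one_ne_zero)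
    have h2 := h1.sub (hn.mul_const (Real.log M))
    simpa using h2
  have hlim' := (continuous_coe_real_ereal.tendsto _).comp hlim
  rw [hwE, ← EReal.coe_neg, ← hlim'.liminf_eq]
  refine liminf_le_liminf ?_
  filter_upwards [hpl.eventually (lt_mem_nhds one_pos), eventually_ge_atTop 2] with m hp0 hm
  have h1 := ENNReal.log_monotone (suMass_ge hQ hK hM1 hM hfin hG hm (p := p m) rfl hp0)
  rw [log_ofReal_exp] at h1
  have h2 := mul_le_mul_of_nonneg_left h1
    (by exact_mod_cast (by positivity : (0 : ℝ) ≤ 1 / ((m : ℝ) + 1) ^ 2) :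
      (0 : EReal) ≤ (((1 : ℝ) / ((m : ℝ) + 1) ^ 2 : ℝ) : EReal))
  refine le_trans (le_of_eq ?_) h2
  rw [← EReal.coe_mul, Function.comp_apply]
  congr 1
  have h3 : (m : ℝ) + 1 ≠ 0 := by positivity
  have h4 : p m ≠ 0 := hp0.ne'
  field_simp
  ring

lemma neg_iInf_le_liminf_log_suMass {Q : Circle → ℝ} (hQ : Continuous Q)
    {G : Set (ProbabilityMeasure Circle)} (hG : IsOpen G) :
    -(⨅ μ ∈ G, weightedEnergy Q μ) ≤
      liminf (fun m : ℕ => (((1 : ℝ) / ((m : ℝ) + 1) ^ 2 : ℝ) : EReal) *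
        ENNReal.log (suMass Q m G)) atTop := by
  rw [EReal.neg_le]
  refine le_iInf₂ fun μ hμ => ?_
  by_cases hfin : logEnergy (μ : Measure Circle) = ⊤
  · rw [weightedEnergy, hfin]
    simp
  refine EReal.le_of_forall_lt_iff_le.1 fun y hy => ?_
  rw [weightedEnergy, ← EReal.coe_ennreal_toReal hfin, ← EReal.coe_add, EReal.coe_lt_coe_iff] at hy
  have hU : G ∩ {ν : ProbabilityMeasure Circle | (logEnergy (μ : Measure Circle)).toReal +
      ∫ ζ, Q ζ ∂(ν : Measure Circle) < y} ∈ 𝓝 μ := by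
    refine inter_mem (hG.mem_nhds hμ) (IsOpen.mem_nhds ?_ hy)
    exact isOpen_lt (continuous_const.add (continuous_integral_probabilityMeasure hQ))
      continuous_const
  obtain ⟨ν, ⟨hνG, hνy⟩, ⟨M, hM⟩, hle⟩ := exists_le_smul_circleHaar_mem_nhds μ hU
  have hνfin := ne_top_of_le_ne_top hfin hle
  have h1 := neg_le_liminf_log_suMass hQ hM hνfin hG hνG
  rw [EReal.neg_le] at h1
  refine h1.trans ?_
  rw [weightedEnergy, ← EReal.coe_ennreal_toReal hνfin, ← EReal.coe_add, EReal.coe_le_coe_iff]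
  have h2 := ENNReal.toReal_mono hfin hle
  simp only [Set.mem_ofPred_eq] at hνy
  linarith

lemma prod_circle_exp {ι : Type*} (s : Finset ι) (f : ι → ℝ) :
    ∏ i ∈ s, Circle.exp (f i) = Circle.exp (∑ i ∈ s, f i) := by
  classical
  induction s using Finset.induction_on with
  | empty => simp
  | insert a s ha ih => rw [Finset.prod_insert ha, Finset.sum_insert ha, Circle.exp_add, ih]

lemma exists_suWeight_ne_zero (Q : Circle → ℝ) (m : ℕ) : ∃ z, suWeight Q m z ≠ 0 := by
  set t : ℝ := -(Real.pi * m / (m + 1))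
  set θ : Fin (m + 1) → ℝ := fun j => 2 * Real.pi * j / (m + 1) + t with hθ
  have hsum : ∑ j, θ j = 0 := by
    have h1 : ∑ j : Fin (m + 1), (j : ℝ) = m * (m + 1) / 2 := by
      rw [Fin.sum_univ_eq_sum_range (fun j => (j : ℝ)), ← Nat.cast_sum, Finset.sum_range_id]
      rw [Nat.cast_div (by simpa [mul_comm] using (Nat.even_mul_succ_self m).two_dvd) (by norm_num)]
      push_cast [Nat.add_sub_cancel]
      ring
    simp only [hθ, Finset.sum_add_distrib, ← Finset.sum_div, ← Finset.mul_sum, h1]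
    simp only [Finset.sum_const, Finset.card_univ, Fintype.card_fin, nsmul_eq_mul, t]
    push_cast
    field_simp
    ring
  set z : Fin m → Circle := fun i => Circle.exp (θ i.castSucc) with hz
  have htuple : ∀ j, suTuple z j = Circle.exp (θ j) := by
    intro j
    refine Fin.lastCases ?_ (fun i => ?_) j
    · rw [suTuple_last, hz]
      have h2 : ∏ i : Fin m, Circle.exp (θ i.castSucc) =
          Circle.exp (∑ i : Fin m, θ i.castSucc) := prod_circle_exp _ _
      rw [h2, ← Circle.exp_neg]
      rw [Fin.sum_univ_castSucc] at hsum
      congr 1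
      linarith
    · rw [suTuple_castSucc]
  have hinj : Function.Injective fun j => Circle.exp (θ j) := by
    intro i j hij
    have hmem : ∀ j, θ j ∈ Set.Ico t (t + 2 * Real.pi) := by
      intro j
      have hj : (j : ℝ) < m + 1 := by exact_mod_cast j.is_lt
      refine ⟨le_add_of_nonneg_left (by positivity), ?_⟩
      simp only [hθ]
      rw [add_comm t, add_lt_add_iff_right, div_lt_iff₀ (by positivity)]
      nlinarith [Real.pi_pos]
    have h3 := Circle.exp_injOn_Ico (by linarith : t + 2 * Real.pi - t ≤ 2 * Real.pi)
      (hmem i) (hmem j) hij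
    simp only [hθ] at h3
    have h4 : (i : ℝ) = j := by
      have := Real.pi_pos
      field_simp at h3
      nlinarith
    exact Fin.ext (by exact_mod_cast h4)
  refine ⟨z, mul_ne_zero (Real.exp_pos _).ne' ?_⟩
  refine Finset.prod_ne_zero_iff.2 fun i _ => Finset.prod_ne_zero_iff.2 fun j hj => ?_
  refine pow_ne_zero _ (norm_ne_zero_iff.2 (sub_ne_zero.2 fun h => ?_))
  rw [Circle.coe_inj, htuple, htuple] at h
  exact (Finset.mem_Ioi.1 hj).ne (hinj h)

lemma suPartition_ne_zero {Q : Circle → ℝ} (hQ : Continuous Q) (m : ℕ) : suPartition Q m ≠ 0 := by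
  intro h
  have hc := continuous_suWeight hQ m
  rw [suPartition, lintegral_eq_zero_iff hc.measurable.ennreal_ofReal] at h
  have h2 : suWeight Q m =ᵐ[Measure.pi fun _ => circleHaar] fun _ => 0 := by
    filter_upwards [h] with z hz
    exact le_antisymm (ENNReal.ofReal_eq_zero.1 hz) (suWeight_nonneg Q m z)
  have h3 := (hc.ae_eq_iff_eq _ continuous_const).1 h2
  obtain ⟨z, hz⟩ := exists_suWeight_ne_zero Q m
  exact hz (congrFun h3 z)

lemma suPartition_ne_top {Q : Circle → ℝ} (hQ : Continuous Q) (m : ℕ) : suPartition Q m ≠ ⊤ :=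
  (integrable_of_continuous (μ := Measure.pi fun _ : Fin m => circleHaar)
    (continuous_suWeight hQ m)).lintegral_lt_top.ne

lemma suEigenvalueLaw_apply (Q : Circle → ℝ) (m : ℕ) {A : Set (ProbabilityMeasure Circle)}
    (hA : MeasurableSet ((fun z : Fin m → Circle => empiricalMeasure (suTuple z)) ⁻¹' A)) :
    suEigenvalueLaw Q m ((fun z => empiricalMeasure (suTuple z)) ⁻¹' A) =
      (suPartition Q m)⁻¹ * suMass Q m A := by
  rw [suEigenvalueLaw, Measure.smul_apply, withDensity_apply _ hA, smul_eq_mul, suMass]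

lemma mul_log_suEigenvalueLaw (Q : Circle → ℝ) (m : ℕ) {A : Set (ProbabilityMeasure Circle)}
    (hA : MeasurableSet ((fun z : Fin m → Circle => empiricalMeasure (suTuple z)) ⁻¹' A)) :
    (((1 : ℝ) / ((m : ℝ) + 1) ^ 2 : ℝ) : EReal) *
      ENNReal.log (suEigenvalueLaw Q m ((fun z => empiricalMeasure (suTuple z)) ⁻¹' A)) =
    -((((1 : ℝ) / ((m : ℝ) + 1) ^ 2 : ℝ) : EReal) * ENNReal.log (suPartition Q m)) +
      (((1 : ℝ) / ((m : ℝ) + 1) ^ 2 : ℝ) : EReal) * ENNReal.log (suMass Q m A) := by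
  rw [suEigenvalueLaw_apply Q m hA, ENNReal.log_mul_add, ENNReal.log_inv,
    EReal.left_distrib_of_nonneg_of_ne_top
      (by exact_mod_cast (by positivity : (0 : ℝ) ≤ 1 / ((m : ℝ) + 1) ^ 2)) (EReal.coe_ne_top _),
    mul_neg]

lemma isProbabilityMeasure_suEigenvalueLaw {Q : Circle → ℝ} (hQ : Continuous Q) (m : ℕ) :
    IsProbabilityMeasure (suEigenvalueLaw Q m) := by
  constructor
  have h := suEigenvalueLaw_apply Q m (A := Set.univ) (by simp)
  rw [Set.preimage_univ, suMass_univ] at h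
  rw [h]
  exact ENNReal.inv_mul_cancel (suPartition_ne_zero hQ m) (suPartition_ne_top hQ m)

lemma EReal.biInf_add_coe {α : Type*} (s : Set α) (f : α → EReal) (c : ℝ) :
    ⨅ x ∈ s, (f x + (c : EReal)) = (⨅ x ∈ s, f x) + (c : EReal) := by
  apply le_antisymm
  · rw [← EReal.sub_le_iff_le_add (Or.inl (EReal.coe_ne_bot c)) (Or.inl (EReal.coe_ne_top c))]
    refine le_iInf₂ fun x hx => ?_
    rw [EReal.sub_le_iff_le_add (Or.inl (EReal.coe_ne_bot c)) (Or.inl (EReal.coe_ne_top c))]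
    exact iInf₂_le x hx
  · exact le_iInf₂ fun x hx => add_le_add_left (iInf₂_le x hx) _

theorem theorem1p2 (Q : Circle → ℝ) (hQ : Continuous Q) :
    ∃ B : ℝ,
      Tendsto (fun m : ℕ => (((1 : ℝ) / ((m : ℝ) + 1) ^ 2 : ℝ) : EReal) *
        ENNReal.log (suPartition Q m)) atTop (𝓝 (B : EReal)) ∧
      SatisfiesLDP (fun m : ℕ => suEigenvalueLaw Q m)
        (fun _ z => empiricalMeasure (suTuple z))
        (fun m : ℕ => (1 : ℝ) / ((m : ℝ) + 1) ^ 2)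
        (relFreeEntropy Q B) ∧
      ∃ μQ : ProbabilityMeasure Circle,
        (∀ ν, relFreeEntropy Q B μQ ≤ relFreeEntropy Q B ν) ∧
        (∀ μ, (∀ ν, relFreeEntropy Q B μ ≤ relFreeEntropy Q B ν) → μ = μQ) ∧
        relFreeEntropy Q B μQ = 0 := by
  obtain ⟨μQ, hmin⟩ := exists_minimizer_weightedEnergy hQ
  have hne_top : weightedEnergy Q μQ ≠ ⊤ := by
    have h : weightedEnergy Q ⟨circleHaar, inferInstance⟩ ≠ ⊤ := by
      simp only [weightedEnergy, ProbabilityMeasure.coe_mk, logEnergy_circleHaar]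
      simp
    exact ne_top_of_le_ne_top h (hmin _)
  have hne_bot := weightedEnergy_ne_bot Q μQ
  obtain ⟨b, hb⟩ : ∃ b : ℝ, weightedEnergy Q μQ = (b : EReal) :=
    ⟨_, (EReal.coe_toReal hne_top hne_bot).symm⟩
  have hInf : ⨅ μ ∈ (Set.univ : Set (ProbabilityMeasure Circle)), weightedEnergy Q μ = (b : EReal) := by
    refine le_antisymm (hb ▸ iInf₂_le μQ trivial) (le_iInf₂ fun μ _ => hb ▸ hmin μ)
  have hlim : Tendsto (fun m : ℕ => (((1 : ℝ) / ((m : ℝ) + 1) ^ 2 : ℝ) : EReal) *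
      ENNReal.log (suPartition Q m)) atTop (𝓝 ((-b : ℝ) : EReal)) := by
    simp_rw [← suMass_univ]
    have h1 := limsup_log_suMass_le hQ isClosed_univ
    have h2 := neg_iInf_le_liminf_log_suMass hQ isOpen_univ
    rw [hInf, ← EReal.coe_neg] at h1 h2
    exact tendsto_of_le_liminf_of_limsup_le h2 h1
  have hrel : ∀ μ, relFreeEntropy Q (-b) μ = weightedEnergy Q μ + ((-b : ℝ) : EReal) :=
    relFreeEntropy_eq Q (-b)
  have hmono : ∀ μ ν, relFreeEntropy Q (-b) μ ≤ relFreeEntropy Q (-b) ν ↔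
      weightedEnergy Q μ ≤ weightedEnergy Q ν := by
    intro μ ν
    rw [hrel, hrel]
    refine ⟨fun h => ?_, fun h => by gcongr⟩
    rwa [← EReal.sub_le_iff_le_add (Or.inl (EReal.coe_ne_bot _)) (Or.inl (EReal.coe_ne_top _)),
      EReal.add_sub_cancel_right] at h
  have hzero : relFreeEntropy Q (-b) μQ = 0 := by
    rw [hrel, hb, ← EReal.coe_add, add_neg_cancel, EReal.coe_zero]
  have hnegZ : Tendsto (fun m : ℕ => -((((1 : ℝ) / ((m : ℝ) + 1) ^ 2 : ℝ) : EReal) *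
      ENNReal.log (suPartition Q m))) atTop (𝓝 (b : EReal)) := by
    have := (continuous_neg.tendsto (((-b : ℝ)) : EReal)).comp hlim
    rwa [← EReal.coe_neg, neg_neg] at this
  have hsc : LowerSemicontinuous (relFreeEntropy Q (-b)) := by
    intro μ c hc
    rw [hrel] at hc
    have hc' : c - ((-b : ℝ) : EReal) < weightedEnergy Q μ := EReal.sub_lt_of_lt_add hc
    filter_upwards [lowerSemicontinuous_weightedEnergy hQ μ _ hc'] with ν hν
    rw [hrel]
    exact (EReal.sub_lt_iff (Or.inl (EReal.coe_ne_bot _)) (Or.inl (EReal.coe_ne_top _))).1 hν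
  have hneg : ∀ A : Set (ProbabilityMeasure Circle),
      -(⨅ μ ∈ A, relFreeEntropy Q (-b) μ) = (b : EReal) + -(⨅ μ ∈ A, weightedEnergy Q μ) := by
    intro A
    simp_rw [hrel]
    rw [EReal.biInf_add_coe, EReal.neg_add (Or.inr (EReal.coe_ne_top _))
      (Or.inr (EReal.coe_ne_bot _)), sub_eq_add_neg, ← EReal.coe_neg, neg_neg, add_comm]
  refine ⟨-b, hlim, ⟨isProbabilityMeasure_suEigenvalueLaw hQ, ?_, ?_, hsc, ?_, ?_, ?_⟩, μQ, ?_, ?_,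
    hzero⟩
  · exact fun m G hG => (hG.preimage (continuous_empiricalMeasure_suTuple m)).measurableSet
  · exact fun μ => hzero ▸ (hmono μQ μ).2 (hmin μ)
  · exact fun c => (hsc.isClosed_preimage (c : EReal)).isCompact
  · intro F hF
    have hmeas := fun m : ℕ =>
      (hF.preimage (continuous_empiricalMeasure_suTuple m)).measurableSet
    simp_rw [mul_log_suEigenvalueLaw Q _ (hmeas _)]
    refine (EReal.limsup_add_le ?_ ?_).trans ?_
    · exact Or.inl (by rw [hnegZ.limsup_eq]; exact EReal.coe_ne_bot _)
    · exact Or.inl (by rw [hnegZ.limsup_eq]; exact EReal.coe_ne_top _)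
    rw [hnegZ.limsup_eq, hneg]
    gcongr
    exact limsup_log_suMass_le hQ hF
  · intro G hG
    have hmeas := fun m : ℕ =>
      (hG.preimage (continuous_empiricalMeasure_suTuple m)).measurableSet
    simp_rw [mul_log_suEigenvalueLaw Q _ (hmeas _)]
    refine le_trans ?_ (EReal.le_liminf_add)
    rw [hnegZ.liminf_eq, hneg]
    gcongr
    exact neg_iInf_le_liminf_log_suMass hQ hG
  · exact fun ν => (hmono μQ ν).2 (hmin ν)
  · exact fun μ hμ => weightedEnergy_minimizer_unique hQ hmin
      (fun ρ => (hmono μ ρ).1 (hμ ρ)) hne_top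

end
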